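/- Let $\mathcal H$ be a real separable Hilbert space, let $A\colon\mathcal H\to 2^{\mathcal H}$ be maximally monotone, and let $B\colon\mathcal H\to\mathcal H$ be monotone and $\mu$-Lipschitz with $\mu\in\,]0,\infty[$. Write $\operatorname{dom}A=\{x: Ax\neq\varnothing\}$, $\operatorname{zer}(A+B)=\{x: 0\in Ax+Bx\}$ and $J_{\gamma A}=(\mathrm{Id}+\gamma A)^{-1}$. Let $(\Omega,\mathcal F,\mathsf P)$ be a probability space, let $(\gamma_n)_{n\in\mathbb N}$ be a sequence in $\,]0,(\sqrt2-1)/\mu[$, let $x_{-1},x_0$ be square integrable $\mathcal H$-valued random variables, and let $(x_n)_{n\ge 1}$ and $(r_n)_{n\in\mathbb N}$ be $\mathcal H$-valued random variables, the $r_n$ integrable, such that for every $n\in\mathbb N$, almost surely, $$y_n=2x_n-x_{n-1},\qquad \mathsf E[r_n\mid\mathcal F_n]=By_n,\qquad x_{n+1}=J_{\gamma_nA}(x_n-\gamma_nr_n),$$ where $\mathcal F_n=\sigma(x_0,\dots,x_n)$. Conditional expectations of nonnegative random variables are taken with values in $[0,\infty]$. (i) Suppose that $\operatorname{zer}(A+B)\neq\varnothing$,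 that $(\gamma_n)$ is nondecreasing with $$\inf_{n\ge 1}\Big(\frac{2}{\gamma_n}-\frac1{\gamma_{n-1}}-\mu(1+\sqrt2)\Big)>0,$$ and that $\sum_{n\in\mathbb N}\mathsf E[\|r_n-By_n\|^2\mid\mathcal F_n]<\infty$ almost surely. Then there is a random variable $\overline x\colon\Omega\to\operatorname{zer}(A+B)$ such that $x_n$ converges weakly to $\overline x$ almost surely. (ii) Suppose that $\operatorname{dom}A$ is bounded, that $A$ or $B$ is uniformly monotone, that $(\gamma_n)$ is decreasing (in the wide sense) with $\sum_n\gamma_n^2<\infty$ and $\sum_n\gamma_n=\infty$, and that $\sum_{n\in\mathbb N}\gamma_n^2\,\mathsf E[\|r_n-By_n\|^2\mid\mathcal F_n]<\infty$ almost surely. Then $\operatorname{zer}(A+B)$ consists of exactly one point $\overline x$, and $x_n$ converges strongly to $\overline x$ almost surely. Here a set-valued operator $C$ (a single-valued operator being identified with the set-valued one with singleton values) is called uniformly monotone if for every $x\in\operatorname{dom}C$ there is an increasing (in the wide sense) function $\phi\colon[0,\infty[\,\to[0,\infty]$ vanishing only at $0$ such that $\langle x-y,u-v\rangle\ge\phi(\|y-x\|)$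 for all $u\in Cx$ and all $y\in\mathcal H$, $v\in Cy$; in particular, operators that are uniformly monotone with one $\phi$ for all $x$ are covered. -/

import Mathlib

open MeasureTheory Filter Topology
open scoped Pointwise ENNReal NNReal

namespace SetValued

variable {H : Type*} [NormedAddCommGroup H] [InnerProductSpace ℝ H]

/-- The domain of a set-valued operator `A : H → 2^H`. -/
def dom (A : H → Set H) : Set H := {x | (A x).Nonempty}

/-- The graph of a set-valued operator. -/
def gra (A : H → Set H) : Set (H × H) := {p | p.2 ∈ A p.1}

/-- The inverse `A⁻¹ : u ↦ {x | u ∈ A x}`. -/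
def inv (A : H → Set H) : H → Set H := fun u => {x | u ∈ A x}

/-- The zero set `A⁻¹ 0`. -/
def zer (A : H → Set H) : Set H := inv A 0

/-- A single-valued operator regarded as a set-valued one. -/
def ofFun (B : H → H) : H → Set H := fun x => {B x}

/-- The sum `x ↦ A x + C x` (Minkowski sum of the values). -/
def sum (A C : H → Set H) : H → Set H := fun x => A x + C x

/-- The multiple `x ↦ c • A x`. -/
def scale (c : ℝ) (A : H → Set H) : H → Set H := fun x => c • A x

/-- The resolvent `J_A = (Id + A)⁻¹`, as a set-valued operator. When `A` is monotone, its values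
have at most one element, so that `p ∈ resolvent A z` says `p = J_A z`. -/
def resolvent (A : H → Set H) : H → Set H := inv (sum (ofFun id) A)

def IsMonotone (A : H → Set H) : Prop :=
  ∀ p ∈ gra A, ∀ q ∈ gra A, 0 ≤ inner ℝ (p.1 - q.1) (p.2 - q.2)

/-- Monotone, with no monotone operator whose graph properly contains the graph of `A`. -/
def IsMaximallyMonotone (A : H → Set H) : Prop :=
  IsMonotone A ∧ ¬ ∃ C : H → Set H, IsMonotone C ∧ gra A ⊂ gra C

/-- `A` is `φ`-uniformly monotone at `x`, where `φ : [0, ∞[ → [0, ∞]` is increasing and vanishes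
only at `0`. -/
def IsUniformlyMonotoneAt (A : H → Set H) (φ : ℝ≥0 → ℝ≥0∞) (x : H) : Prop :=
  Monotone φ ∧ (∀ t, φ t = 0 ↔ t = 0) ∧
    ∀ u ∈ A x, ∀ q ∈ gra A,
      ((φ ‖q.1 - x‖₊ : ℝ≥0∞) : EReal) ≤ ((inner ℝ (x - q.1) (u - q.2) : ℝ) : EReal)

/-- `A` is uniformly monotone: at each point of its domain it is `φ`-uniformly monotone for some
modulus `φ`. (A single modulus for all points is a special case.) -/
def IsUniformlyMonotone (A : H → Set H) : Prop :=
  ∀ x ∈ dom A, ∃ φ : ℝ≥0 → ℝ≥0∞, IsUniformlyMonotoneAt A φ x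

end SetValued

section Algorithm

variable {Ω H : Type*} [NormedAddCommGroup H] [InnerProductSpace ℝ H]

/-- The reflected points `y 0 = 2 x 0 - x₋₁` and `y n = 2 x n - x (n - 1)` for `1 ≤ n`; here `xm`
is `x₋₁`. -/
def reflectedPoint (xm : Ω → H) (x : ℕ → Ω → H) : ℕ → Ω → H
  | 0 => fun ω => (2 : ℝ) • x 0 ω - xm ω
  | n + 1 => fun ω => (2 : ℝ) • x (n + 1) ω - x n ω

/-- The σ-algebra `F n = σ(x 0, …, x n)`. -/
abbrev pastSigma [MeasurableSpace H] (x : ℕ → Ω → H) (n : ℕ) : MeasurableSpace Ω :=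
  ⨆ k : ℕ, ⨆ _ : k ≤ n, MeasurableSpace.comap (x k) inferInstance

/-- `x` is a sequence of random vectors generated, from the square integrable `x₋₁ = xm` and
`x 0`, by the stochastic reflected forward-backward iteration with step sizes `γ` and stochastic
estimates `r`. Equalities between random vectors hold almost surely. -/
structure IsStochasticReflectedFB [CompleteSpace H] [MeasurableSpace H] [MeasurableSpace Ω]
    (P : Measure Ω) (A : H → Set H) (B : H → H) (γ : ℕ → ℝ) (xm : Ω → H)
    (x r : ℕ → Ω → H) : Prop where
  step_pos : ∀ n, 0 < γ n
  memLp_prev : MemLp xm 2 P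
  memLp_zero : MemLp (x 0) 2 P
  measurable : ∀ n, Measurable (x n)
  integrable : ∀ n, Integrable (r n) P
  unbiased : ∀ n, P[r n | pastSigma x n] =ᵐ[P] fun ω => B (reflectedPoint xm x n ω)
  iterate : ∀ n, ∀ᵐ ω ∂P,
    x (n + 1) ω ∈ SetValued.resolvent (SetValued.scale (γ n) A) (x n ω - γ n • r n ω)

/-- The conditional variance `E[‖r n - B (y n)‖² | F n]`, a `[0, ∞]`-valued random variable. -/
noncomputable def estimatorVariance [MeasurableSpace H] [MeasurableSpace Ω]
    (P : Measure Ω) (B : H → H) (xm : Ω → H) (x r : ℕ → Ω → H) (n : ℕ) : Ω → ℝ≥0∞ :=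
  condLExp (pastSigma x n) P fun ω => ‖r n ω - B (reflectedPoint xm x n ω)‖ₑ ^ 2

end Algorithm

/-!
The iteration `x (n + 1) = J (x n - γ n • r n)` says that `u (n + 1) = (x n - x (n + 1)) / γ n - r n`
belongs to `A (x (n + 1))`. Fix a zero `z` of `A + B` and write `e n = r n - B (y n)` for the noise.
Monotonicity of `A` and `B` turns one step into a pathwise descent inequality
`V (n + 1) + θ n ≤ V n + (multiples of ‖e n‖² and ‖e (n - 1)‖²) + ⟪c n, e n⟫`, where the term linear
in the noise has a coefficient `c n` known at time `n`.

* For nondecreasing steps `V` is `reflectedEnergy`, which dominates a multiple of `‖x n - z‖²`, and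
  `θ n` is a multiple of `‖x (n + 1) - x n‖²`; see `reflectedEnergy_step_le`. Besides the inequality
  tested at `z`, the estimate uses monotonicity of `A` between `x n` and `x (n + 1)` to absorb the
  difference `B (y n) - B (y (n - 1))`.
* For square summable steps and bounded `dom A`, all values of `B` that occur are bounded, so the
  cruder `V n = ‖x n - z‖² + ‖x n - x (n - 1)‖² / 4` suffices and `θ n` retains the gain from
  uniform monotonicity; see `norm_add_sq_add_le`.

A Robbins–Siegmund theorem, `ae_tendsto_and_tsum_ne_top_of_noisy_descent`, then gives almost sure
convergence of `V` and summability of `θ`. Neither `x n` nor the noise need be square integrable, so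
all expectations are taken over events on which the accumulated conditional variances stay below a
constant; on these the linear noise term has mean zero, after a further truncation of `c n`, and the
compensated process is an `L¹`-bounded supermartingale.

In the first case the distances to all points of a countable dense set of zeros converge almost
surely. The elements `u (n + 1) + B (x (n + 1))` of `(A + B) (x (n + 1))` tend to `0`, so weak cluster
points are zeros, and Opial's lemma gives weak convergence; the limit is measurable because weak and
Borel measurability agree in a separable space. In the second case `∑ γ n = ∞` forces the distance
to `z` to tend to `0`.

That weak cluster points are zeros, and that zeros exist when `dom A` is bounded, both rest on the
maximality of `A + B`. It comes from Minty's theorem for `A`, proved by minimizing the sum of the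
Fitzpatrick function of `A` and `(‖x‖² + ‖u‖²) / 2`, together with a contraction argument that adds
the Lipschitz operator `B`.
-/

/-! ### Minty's theorem and resolvents -/

namespace SetValued

variable {H : Type*} [NormedAddCommGroup H] [InnerProductSpace ℝ H]

theorem IsMonotone.inner_nonneg {A : H → Set H} (hA : IsMonotone A) {x y u v : H} (hu : u ∈ A x)
    (hv : v ∈ A y) : 0 ≤ inner ℝ (x - y) (u - v) :=
  hA (x, u) hu (y, v) hv

/-- A point monotonically related to the whole graph of a maximally monotone operator lies on that
graph. -/
theorem IsMaximallyMonotone.mem_of_forall_inner_nonneg {A : H → Set H}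
    (hA : IsMaximallyMonotone A) {x u : H}
    (h : ∀ y, ∀ v ∈ A y, 0 ≤ inner ℝ (y - x) (v - u)) : u ∈ A x := by
  by_contra hxu
  refine hA.2 ⟨fun y => {v | v ∈ A y ∨ (y = x ∧ v = u)}, ?_, ?_, ?_⟩
  · rintro ⟨y, v⟩ hp ⟨y', v'⟩ hq
    rcases hp with hp | ⟨h1, h2⟩ <;> rcases hq with hq | ⟨h3, h4⟩
    · exact hA.1 (y, v) hp (y', v') hq
    · simp only at h3 h4 ⊢
      rw [h3, h4]
      exact h y v hp
    · simp only at h1 h2 ⊢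
      rw [h1, h2, ← neg_sub y' x, ← neg_sub v' u, inner_neg_neg]
      exact h y' v' hq
    · simp only at h1 h2 h3 h4 ⊢
      simp [h1, h3]
  · exact fun p hp => Or.inl hp
  · intro hsub
    exact hxu (hsub (show (x, u) ∈ gra _ from Or.inr ⟨rfl, rfl⟩))

/-- The epigraph of the Fitzpatrick function of the monotone set `G`. -/
def fitzpatrickEpigraph (G : Set (H × H)) : Set (H × H × ℝ) :=
  {e | ∀ p ∈ G, inner ℝ e.1 p.2 + inner ℝ p.1 e.2.1 - inner ℝ p.1 p.2 ≤ e.2.2}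

/-- The functional `F(x, u) + ‖x‖² / 2 + ‖u‖² / 2`, read on the epigraph of `F`. -/
noncomputable def regularizedHeight (e : H × H × ℝ) : ℝ :=
  e.2.2 + ‖e.1‖ ^ 2 / 2 + ‖e.2.1‖ ^ 2 / 2

theorem mem_fitzpatrickEpigraph_of_mem {G : Set (H × H)}
    (hmono : ∀ p ∈ G, ∀ q ∈ G, 0 ≤ inner ℝ (p.1 - q.1) (p.2 - q.2)) {p : H × H} (hp : p ∈ G) :
    (p.1, p.2, inner ℝ p.1 p.2) ∈ fitzpatrickEpigraph G := by
  intro q hq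
  have := hmono p hp q hq
  simp only [inner_sub_left, inner_sub_right] at this ⊢
  linarith

/-- The Fitzpatrick function of a maximally monotone set dominates the duality pairing. -/
theorem inner_le_of_mem_fitzpatrickEpigraph {G : Set (H × H)}
    (hmax : ∀ x u : H, (∀ p ∈ G, 0 ≤ inner ℝ (p.1 - x) (p.2 - u)) → (x, u) ∈ G)
    {e : H × H × ℝ} (he : e ∈ fitzpatrickEpigraph G) : inner ℝ e.1 e.2.1 ≤ e.2.2 := by
  by_contra! hlt
  refine absurd (hmax e.1 e.2.1 fun p hp => ?_) fun hmem => ?_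
  · have := he p hp
    simp only [inner_sub_left, inner_sub_right]
    linarith
  · have := he _ hmem
    simp only at this
    linarith

theorem add_smul_mem_fitzpatrickEpigraph {G : Set (H × H)} {e f : H × H × ℝ}
    (he : e ∈ fitzpatrickEpigraph G) (hf : f ∈ fitzpatrickEpigraph G) {s : ℝ} (h0 : 0 ≤ s)
    (h1 : s ≤ 1) :
    (e.1 + s • (f.1 - e.1), e.2.1 + s • (f.2.1 - e.2.1), e.2.2 + s * (f.2.2 - e.2.2)) ∈
      fitzpatrickEpigraph G := by
  intro p hp
  have h2 := mul_le_mul_of_nonneg_left (he p hp) (sub_nonneg.2 h1)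
  have h3 := mul_le_mul_of_nonneg_left (hf p hp) h0
  simp only [inner_add_left, inner_add_right, real_inner_smul_left, real_inner_smul_right,
    inner_sub_left, inner_sub_right]
  linarith

theorem regularizedHeight_add_smul (e f : H × H × ℝ) (s : ℝ) :
    regularizedHeight
        (e.1 + s • (f.1 - e.1), e.2.1 + s • (f.2.1 - e.2.1), e.2.2 + s * (f.2.2 - e.2.2)) =
      regularizedHeight e + s * (f.2.2 - e.2.2 + inner ℝ e.1 (f.1 - e.1)
        + inner ℝ e.2.1 (f.2.1 - e.2.1))
        + s ^ 2 * (‖f.1 - e.1‖ ^ 2 / 2 + ‖f.2.1 - e.2.1‖ ^ 2 / 2) := by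
  simp only [regularizedHeight, norm_add_sq_real, real_inner_smul_right, norm_smul, mul_pow,
    Real.norm_eq_abs, sq_abs]
  ring

/-- The regularized Fitzpatrick function of a maximally monotone set attains its minimum: by the
parallelogram law its minimizing sequences are Cauchy. -/
theorem exists_isMinOn_regularizedHeight [CompleteSpace H] {G : Set (H × H)}
    (hne : G.Nonempty) (hmono : ∀ p ∈ G, ∀ q ∈ G, 0 ≤ inner ℝ (p.1 - q.1) (p.2 - q.2))
    (hmax : ∀ x u : H, (∀ p ∈ G, 0 ≤ inner ℝ (p.1 - x) (p.2 - u)) → (x, u) ∈ G) :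
    ∃ e ∈ fitzpatrickEpigraph G, IsMinOn regularizedHeight (fitzpatrickEpigraph G) e := by
  set E := fitzpatrickEpigraph G
  have hnn : ∀ e ∈ E, 0 ≤ regularizedHeight e := by
    intro e he
    have h1 := inner_le_of_mem_fitzpatrickEpigraph hmax he
    have h2 := norm_add_sq_real e.1 e.2.1
    unfold regularizedHeight
    nlinarith [sq_nonneg ‖e.1 + e.2.1‖]
  obtain ⟨p, hp⟩ := hne
  have hEne : (regularizedHeight '' E).Nonempty :=
    ⟨_, _, mem_fitzpatrickEpigraph_of_mem hmono hp, rfl⟩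
  have hbdd : BddBelow (regularizedHeight '' E) := ⟨0, by rintro _ ⟨e, he, rfl⟩; exact hnn e he⟩
  set m := sInf (regularizedHeight '' E)
  have hle : ∀ e ∈ E, m ≤ regularizedHeight e := fun e he => csInf_le hbdd ⟨e, he, rfl⟩
  have hex : ∀ k : ℕ, ∃ e ∈ E, regularizedHeight e < m + 1 / ((k : ℝ) + 1) := by
    intro k
    obtain ⟨_, ⟨e, he, rfl⟩, hlt⟩ := exists_lt_of_csInf_lt hEne
      (show m < m + 1 / ((k : ℝ) + 1) by linarith [Nat.one_div_pos_of_nat (α := ℝ) (n := k)])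
    exact ⟨e, he, hlt⟩
  choose e heE helt using hex
  have hpar : ∀ i j N : ℕ, N ≤ i → N ≤ j →
      ‖(e j).1 - (e i).1‖ ^ 2 + ‖(e j).2.1 - (e i).2.1‖ ^ 2 ≤ 8 * (1 / ((N : ℝ) + 1)) := by
    intro i j N hi hj
    have h1 := hle _ (add_smul_mem_fitzpatrickEpigraph (heE i) (heE j) (s := 1 / 2)
      (by norm_num) (by norm_num))
    rw [regularizedHeight_add_smul] at h1
    have h2 := regularizedHeight_add_smul (e i) (e j) 1
    simp only [one_smul, one_mul, add_sub_cancel] at h2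
    have h3 := (helt i).le.trans (add_le_add_right (Nat.one_div_le_one_div (α := ℝ) hi) m)
    have h4 := (helt j).le.trans (add_le_add_right (Nat.one_div_le_one_div (α := ℝ) hj) m)
    have h5 : regularizedHeight ((e j).1, (e j).2.1, (e j).2.2) = regularizedHeight (e j) := rfl
    rw [h5] at h2
    linarith
  have hlim : Tendsto (fun N : ℕ => √(8 * (1 / ((N : ℝ) + 1)))) atTop (𝓝 0) := by
    have := ((tendsto_one_div_add_atTop_nhds_zero_nat (𝕜 := ℝ)).const_mul 8).sqrt
    simpa using this
  have hcx : CauchySeq fun k => (e k).1 := by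
    refine cauchySeq_of_le_tendsto_0 _ (fun i j N hi hj => ?_) hlim
    rw [dist_eq_norm]
    exact Real.le_sqrt_of_sq_le (by nlinarith [hpar j i N hj hi, sq_nonneg ‖(e i).2.1 - (e j).2.1‖])
  have hcu : CauchySeq fun k => (e k).2.1 := by
    refine cauchySeq_of_le_tendsto_0 _ (fun i j N hi hj => ?_) hlim
    rw [dist_eq_norm]
    exact Real.le_sqrt_of_sq_le (by nlinarith [hpar j i N hj hi, sq_nonneg ‖(e i).1 - (e j).1‖])
  obtain ⟨x, hx⟩ := cauchySeq_tendsto_of_complete hcx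
  obtain ⟨u, hu⟩ := cauchySeq_tendsto_of_complete hcu
  refine ⟨(x, u, m - ‖x‖ ^ 2 / 2 - ‖u‖ ^ 2 / 2), ?_, ?_⟩
  · intro p hp
    have h1 : Tendsto (fun k => inner ℝ (e k).1 p.2 + inner ℝ p.1 (e k).2.1 - inner ℝ p.1 p.2)
        atTop (𝓝 (inner ℝ x p.2 + inner ℝ p.1 u - inner ℝ p.1 p.2)) :=
      ((hx.inner tendsto_const_nhds).add (tendsto_const_nhds.inner hu)).sub_const _
    have h2 : Tendsto (fun k : ℕ => m + 1 / ((k : ℝ) + 1) - ‖(e k).1‖ ^ 2 / 2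
        - ‖(e k).2.1‖ ^ 2 / 2) atTop (𝓝 (m + 0 - ‖x‖ ^ 2 / 2 - ‖u‖ ^ 2 / 2)) :=
      ((tendsto_const_nhds.add tendsto_one_div_add_atTop_nhds_zero_nat).sub
        ((hx.norm.pow 2).div_const 2)).sub ((hu.norm.pow 2).div_const 2)
    rw [add_zero] at h2
    refine le_of_tendsto_of_tendsto' h1 h2 fun k => ?_
    have h3 := heE k p hp
    have h4 := helt k
    unfold regularizedHeight at h4
    linarith
  · intro f hf
    have : regularizedHeight (x, u, m - ‖x‖ ^ 2 / 2 - ‖u‖ ^ 2 / 2) = m := by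
      simp only [regularizedHeight]; ring
    simp only [Set.mem_ofPred_eq, this]
    exact hle f hf

/-- **Minty's theorem** for the graph `G` of a maximally monotone operator: `0` lies in the range
of `Id + G`. -/
theorem exists_neg_mem_of_maximal [CompleteSpace H] {G : Set (H × H)}
    (hmono : ∀ p ∈ G, ∀ q ∈ G, 0 ≤ inner ℝ (p.1 - q.1) (p.2 - q.2))
    (hmax : ∀ x u : H, (∀ p ∈ G, 0 ≤ inner ℝ (p.1 - x) (p.2 - u)) → (x, u) ∈ G) :
    ∃ x : H, (x, -x) ∈ G := by
  have hne : G.Nonempty := by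
    by_contra! h
    have := hmax 0 0 (by simp [h])
    simp [h] at this
  obtain ⟨⟨x, u, t⟩, he, hmin⟩ := exists_isMinOn_regularizedHeight hne hmono hmax
  have hxu := inner_le_of_mem_fitzpatrickEpigraph hmax he
  simp only at hxu
  -- First-order optimality of `(x, u, t)` in the direction of a point of the graph.
  have hopt : ∀ p ∈ G, ‖x + u‖ ^ 2 ≤ inner ℝ (p.1 - -u) (p.2 - -x) := by
    intro p hp
    have hf := mem_fitzpatrickEpigraph_of_mem hmono hp
    have key : 0 ≤ inner ℝ p.1 p.2 - t + inner ℝ x (p.1 - x) + inner ℝ u (p.2 - u) := by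
      set a := inner ℝ p.1 p.2 - t + inner ℝ x (p.1 - x) + inner ℝ u (p.2 - u)
      set b := ‖p.1 - x‖ ^ 2 / 2 + ‖p.2 - u‖ ^ 2 / 2
      have hs : ∀ s : ℝ, 0 < s → s ≤ 1 → 0 ≤ a + s * b := by
        intro s h0 h1
        have h2 := isMinOn_iff.1 hmin _ (add_smul_mem_fitzpatrickEpigraph he hf h0.le h1)
        rw [regularizedHeight_add_smul] at h2
        have h3 : 0 ≤ s * (a + s * b) := by
          simp only [a, b]
          simp only at h2
          linarith
        exact nonneg_of_mul_nonneg_right h3 h0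
      have hlim : Tendsto (fun s : ℝ => a + s * b) (𝓝[>] 0) (𝓝 (a + 0 * b)) :=
        ((continuous_const.add (continuous_id.mul continuous_const)).tendsto 0).mono_left
          nhdsWithin_le_nhds
      rw [zero_mul, add_zero] at hlim
      refine ge_of_tendsto hlim ?_
      filter_upwards [Ioc_mem_nhdsGT (zero_lt_one' ℝ)] with s hs' using hs s hs'.1 hs'.2
    rw [norm_add_sq_real]
    simp only [inner_sub_left, inner_sub_right, inner_neg_left, inner_neg_right,
      real_inner_self_eq_norm_sq] at key ⊢
    have c1 := real_inner_comm p.1 x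
    have c2 := real_inner_comm u x
    linarith
  have hmem : (-u, -x) ∈ G := hmax _ _ fun p hp => (sq_nonneg _).trans (hopt p hp)
  have h0 := hopt _ hmem
  simp only [sub_self, inner_zero_left] at h0
  have h1 : x + u = 0 := by
    have : ‖x + u‖ ^ 2 = 0 := le_antisymm h0 (sq_nonneg _)
    simpa using this
  have h2 : -u = x := by rw [neg_eq_iff_add_eq_zero, add_comm, h1]
  exact ⟨x, by rwa [h2] at hmem⟩

theorem mem_resolvent_scale_iff {A : H → Set H} {c : ℝ} {p w : H} :
    p ∈ resolvent (scale c A) w ↔ ∃ u ∈ A p, p + c • u = w := by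
  simp [resolvent, inv, sum, scale, ofFun, Set.mem_smul_set, eq_neg_add_iff_add_eq]

theorem IsMaximallyMonotone.exists_mem_resolvent [CompleteSpace H] {A : H → Set H}
    (hA : IsMaximallyMonotone A) {c : ℝ} (hc : 0 < c) (w : H) :
    ∃ p, p ∈ resolvent (scale c A) w := by
  suffices h : ∃ x : H, (x, -x) ∈ {p : H × H | c⁻¹ • p.2 ∈ A (p.1 + w)} by
    obtain ⟨x, hx⟩ := h
    refine ⟨x + w, mem_resolvent_scale_iff.2 ⟨_, hx, ?_⟩⟩
    rw [smul_inv_smul₀ hc.ne', add_assoc, add_comm w, ← add_assoc, add_neg_cancel, zero_add]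
  refine exists_neg_mem_of_maximal ?_ ?_
  · intro p hp q hq
    have := hA.1.inner_nonneg hp hq
    rw [add_sub_add_right_eq_sub, ← smul_sub, real_inner_smul_right] at this
    exact nonneg_of_mul_nonneg_right this (inv_pos.2 hc)
  · intro x u h
    refine hA.mem_of_forall_inner_nonneg fun y v hv => ?_
    have h1 := h (y - w, c • v) (by simpa [inv_smul_smul₀ hc.ne'] using hv)
    have h2 : v - c⁻¹ • u = c⁻¹ • (c • v - u) := by rw [smul_sub, inv_smul_smul₀ hc.ne']
    rw [h2, real_inner_smul_right, show y - (x + w) = y - w - x by abel]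
    exact mul_nonneg (inv_nonneg.2 hc.le) h1

/-- The resolvent of a monotone operator is firmly nonexpansive. -/
theorem IsMonotone.norm_sub_sq_le_of_mem_resolvent {A : H → Set H} (hA : IsMonotone A) {c : ℝ}
    (hc : 0 ≤ c) {p q w z : H} (hp : p ∈ resolvent (scale c A) w)
    (hq : q ∈ resolvent (scale c A) z) : ‖p - q‖ ^ 2 ≤ inner ℝ (p - q) (w - z) := by
  obtain ⟨u, hu, rfl⟩ := mem_resolvent_scale_iff.1 hp
  obtain ⟨v, hv, rfl⟩ := mem_resolvent_scale_iff.1 hq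
  have h : p + c • u - (q + c • v) = p - q + c • (u - v) := by rw [smul_sub]; abel
  rw [h, inner_add_right, real_inner_self_eq_norm_sq, real_inner_smul_right]
  linarith [mul_nonneg hc (hA.inner_nonneg hu hv)]

theorem IsMonotone.norm_sub_le_of_mem_resolvent {A : H → Set H} (hA : IsMonotone A) {c : ℝ}
    (hc : 0 ≤ c) {p q w z : H} (hp : p ∈ resolvent (scale c A) w)
    (hq : q ∈ resolvent (scale c A) z) : ‖p - q‖ ≤ ‖w - z‖ := by
  have h1 := (hA.norm_sub_sq_le_of_mem_resolvent hc hp hq).trans (real_inner_le_norm _ _)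
  rcases (norm_nonneg (p - q)).eq_or_lt' with h0 | h0
  · rw [h0]; exact norm_nonneg _
  · rw [sq] at h1
    exact le_of_mul_le_mul_left h1 h0

theorem exists_pos_mul_lt_one (K : ℝ≥0) : ∃ c : ℝ≥0, 0 < c ∧ c * K < 1 := by
  refine ⟨(K + 1)⁻¹, by positivity, ?_⟩
  rw [inv_mul_lt_iff₀ (by positivity), mul_one]
  exact lt_add_one K

theorem mem_zer_sum_ofFun_iff {E : Type*} [NormedAddCommGroup E] {A : E → Set E} {B : E → E}
    {x : E} :
    x ∈ zer (sum A (ofFun B)) ↔ -B x ∈ A x := by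
  simp only [zer, inv, sum, ofFun, Set.mem_ofPred_eq, Set.mem_add, Set.mem_singleton_iff]
  constructor
  · rintro ⟨u, hu, v, rfl, h⟩
    rwa [← eq_neg_of_add_eq_zero_left h]
  · exact fun h => ⟨_, h, _, rfl, neg_add_cancel _⟩

theorem IsMonotone.inner_ofFun_nonneg {B : H → H} (hB : IsMonotone (ofFun B)) (x y : H) :
    0 ≤ inner ℝ (x - y) (B x - B y) :=
  hB.inner_nonneg (x := x) (y := y) rfl rfl

theorem IsMonotone.sum_ofFun {A : H → Set H} {B : H → H} (hA : IsMonotone A)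
    (hB : IsMonotone (ofFun B)) : IsMonotone (sum A (ofFun B)) := by
  rintro ⟨x, _⟩ hx ⟨y, _⟩ hy
  obtain ⟨u, hu, _, rfl, h⟩ := hx
  obtain ⟨v, hv, _, rfl, h'⟩ := hy
  simp only at h h' ⊢
  rw [← h, ← h', add_sub_add_comm, inner_add_right]
  exact add_nonneg (hA.inner_nonneg hu hv) (hB.inner_ofFun_nonneg x y)

theorem mem_resolvent_scale_sum_ofFun_iff {A : H → Set H} {B : H → H} {c : ℝ} {p w : H} :
    p ∈ resolvent (scale c (sum A (ofFun B))) w ↔ ∃ u ∈ A p, p + c • (u + B p) = w := by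
  rw [mem_resolvent_scale_iff]
  constructor
  · rintro ⟨_, ⟨u, hu, _, rfl, rfl⟩, h⟩
    exact ⟨u, hu, h⟩
  · rintro ⟨u, hu, h⟩
    exact ⟨_, ⟨u, hu, _, rfl, rfl⟩, h⟩

/-- For Lipschitz `B` and small `c > 0`, subtracting `c • B` from a fixed vector and then applying
the resolvent of `c • A` is a contraction, whose fixed point is a value of the resolvent of
`c • (A + B)`. -/
theorem IsMaximallyMonotone.exists_mem_resolvent_sum [CompleteSpace H] {A : H → Set H}
    (hA : IsMaximallyMonotone A) {B : H → H} {K : ℝ≥0} (hB : LipschitzWith K B) {c : ℝ≥0}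
    (hc : 0 < c) (hcK : c * K < 1) (w : H) :
    ∃ p, p ∈ resolvent (scale c (sum A (ofFun B))) w := by
  have hc' : (0 : ℝ) < c := hc
  choose J hJ using hA.exists_mem_resolvent hc'
  have hcontr : ContractingWith (c * K) fun x => J (w - (c : ℝ) • B x) := by
    refine ⟨hcK, LipschitzWith.of_dist_le_mul fun x y => ?_⟩
    rw [dist_eq_norm]
    refine (hA.1.norm_sub_le_of_mem_resolvent hc'.le (hJ _) (hJ _)).trans ?_
    rw [sub_sub_sub_cancel_left, ← smul_sub, norm_smul, Real.norm_of_nonneg hc'.le, NNReal.coe_mul,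
      mul_assoc, ← dist_eq_norm, dist_comm x y]
    exact mul_le_mul_of_nonneg_left (hB.dist_le_mul y x) hc'.le
  have hfix := hcontr.fixedPoint_isFixedPt
  set p := ContractingWith.fixedPoint _ hcontr
  have hp := hJ (w - (c : ℝ) • B p)
  rw [show J (w - (c : ℝ) • B p) = p from hfix] at hp
  obtain ⟨u, hu, h⟩ := mem_resolvent_scale_iff.1 hp
  refine ⟨p, mem_resolvent_scale_sum_ofFun_iff.2 ⟨u, hu, ?_⟩⟩
  rw [smul_add, ← add_assoc, h, sub_add_cancel]

/-- The maximality of `A + B`, tested at the zeros: a point `x` for which `(x, 0)` is monotonically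
related to the graph of `A + B` is a zero of `A + B`. -/
theorem IsMaximallyMonotone.mem_zer_of_forall_inner_nonneg [CompleteSpace H] {A : H → Set H}
    (hA : IsMaximallyMonotone A) {B : H → H} {K : ℝ≥0} (hB : LipschitzWith K B) {x : H}
    (h : ∀ y, ∀ v ∈ A y, 0 ≤ inner ℝ (y - x) (v + B y)) : x ∈ zer (sum A (ofFun B)) := by
  obtain ⟨c, hc, hcK⟩ := exists_pos_mul_lt_one K
  have hc' : (0 : ℝ) < c := hc
  obtain ⟨p, hpx⟩ := hA.exists_mem_resolvent_sum hB hc hcK x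
  obtain ⟨u, hu, hp⟩ := mem_resolvent_scale_sum_ofFun_iff.1 hpx
  have h1 : p - x = -((c : ℝ) • (u + B p)) := by rw [← hp]; abel
  have h2 := h p u hu
  rw [h1, inner_neg_left, real_inner_smul_left, real_inner_self_eq_norm_sq] at h2
  have h3 : ‖u + B p‖ ^ 2 = 0 := by nlinarith [sq_nonneg ‖u + B p‖]
  have h4 : u + B p = 0 := by simpa using h3
  have h5 : p = x := by rw [h4] at h1; simpa [sub_eq_zero] using h1
  rw [mem_zer_sum_ofFun_iff, ← h5, ← eq_neg_of_add_eq_zero_left h4]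
  exact hu

/-- The graph of `A + B` is closed for bounded weak convergence in the first variable and strong
convergence in the second one; here the limit in the second variable is `0`. -/
theorem IsMaximallyMonotone.mem_zer_of_tendsto [CompleteSpace H] {A : H → Set H}
    (hA : IsMaximallyMonotone A) {B : H → H} {K : ℝ≥0} (hB : LipschitzWith K B)
    (hBm : IsMonotone (ofFun B)) {ι : Type*} {l : Filter ι} [l.NeBot] {p u : ι → H} {x : H} {R : ℝ}
    (hu : ∀ i, u i ∈ A (p i)) (hR : ∀ i, ‖p i‖ ≤ R)
    (hp : ∀ h, Tendsto (fun i => inner ℝ (p i) h) l (𝓝 (inner ℝ x h)))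
    (h0 : Tendsto (fun i => u i + B (p i)) l (𝓝 0)) : x ∈ zer (sum A (ofFun B)) := by
  refine hA.mem_zer_of_forall_inner_nonneg hB fun y v hv => ?_
  have h1 : Tendsto (fun i => inner ℝ (y - p i) (u i + B (p i))) l (𝓝 0) := by
    refine squeeze_zero_norm (fun i => (norm_inner_le_norm _ _).trans
      (mul_le_mul_of_nonneg_right ((norm_sub_le _ _).trans (add_le_add_right (hR i) ‖y‖))
        (norm_nonneg _))) ?_
    simpa using h0.norm.const_mul (‖y‖ + R)
  have h2 : Tendsto (fun i => inner ℝ y (v + B y) - inner ℝ (p i) (v + B y)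
      - inner ℝ (y - p i) (u i + B (p i))) l
      (𝓝 (inner ℝ y (v + B y) - inner ℝ x (v + B y) - 0)) :=
    ((hp _).const_sub _).sub h1
  rw [sub_zero, ← inner_sub_left] at h2
  refine ge_of_tendsto' h2 fun i => ?_
  have h3 := add_nonneg (hA.1.inner_nonneg hv (hu i)) (hBm.inner_ofFun_nonneg y (p i))
  rw [← inner_add_right, ← add_sub_add_comm, inner_sub_right, inner_sub_left y (p i) (v + B y)]
    at h3
  exact h3

/-- Existence of zeros when the domain is bounded. The points `p n` that solve
`c • (u + B (p n)) = -(p n) / (n + 1)` with `u ∈ A (p n)` have increasing norms and satisfy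
`‖p m - p n‖² ≤ ‖p m‖² - ‖p n‖²` for `n ≤ m`, so they converge strongly as soon as they are
bounded. -/
theorem IsMaximallyMonotone.zer_nonempty_of_isBounded_dom [CompleteSpace H] {A : H → Set H}
    (hA : IsMaximallyMonotone A) {B : H → H} {K : ℝ≥0} (hB : LipschitzWith K B)
    (hBm : IsMonotone (ofFun B)) (hbd : Bornology.IsBounded (dom A)) :
    (zer (sum A (ofFun B))).Nonempty := by
  obtain ⟨c, hc, hcK⟩ := exists_pos_mul_lt_one K
  have hc' : (0 : ℝ) < c := hc
  have hAB := hA.1.sum_ofFun hBm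
  have hreg : ∀ n : ℕ, ∃ p, ∃ u ∈ A p, (c : ℝ) • (u + B p) = -((1 / ((n : ℝ) + 1)) • p) := by
    intro n
    -- `p` is the fixed point of the resolvent of `c • (A + B)` composed with multiplication by `t`.
    set t : ℝ≥0 := n / (n + 1)
    have ht : t < 1 := by
      rw [div_lt_one (by positivity)]
      exact lt_add_one _
    choose J hJ using hA.exists_mem_resolvent_sum hB hc hcK
    have hcontr : ContractingWith t fun x => J ((t : ℝ) • x) := by
      refine ⟨ht, LipschitzWith.of_dist_le_mul fun x y => ?_⟩
      rw [dist_eq_norm]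
      refine (hAB.norm_sub_le_of_mem_resolvent hc'.le (hJ _) (hJ _)).trans ?_
      rw [← smul_sub, norm_smul, Real.norm_of_nonneg t.coe_nonneg, dist_eq_norm]
    have hfix := hcontr.fixedPoint_isFixedPt
    set p := ContractingWith.fixedPoint _ hcontr
    have hp := hJ ((t : ℝ) • p)
    rw [show J ((t : ℝ) • p) = p from hfix] at hp
    obtain ⟨u, hu, h⟩ := mem_resolvent_scale_sum_ofFun_iff.1 hp
    refine ⟨p, u, hu, ?_⟩
    have ht' : (t : ℝ) = 1 - 1 / ((n : ℝ) + 1) := by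
      simp only [t, NNReal.coe_div, NNReal.coe_natCast, NNReal.coe_add, NNReal.coe_one]
      field_simp
      ring
    rw [ht', sub_smul, one_smul] at h
    exact add_left_cancel (h.trans (sub_eq_add_neg _ _))
  choose p u hu hup using hreg
  obtain ⟨R, hR⟩ := hbd.exists_norm_le
  have hpR : ∀ n, ‖p n‖ ≤ R := fun n => hR _ ⟨_, hu n⟩
  have hdiff : ∀ n m, n ≤ m → ‖p m - p n‖ ^ 2 ≤ ‖p m‖ ^ 2 - ‖p n‖ ^ 2 := by
    intro n m hnm
    rcases hnm.eq_or_lt with rfl | hlt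
    · simp
    have h1 := mul_nonneg hc'.le
      (hAB (p n, u n + B (p n)) ⟨_, hu n, _, rfl, rfl⟩ (p m, u m + B (p m)) ⟨_, hu m, _, rfl, rfl⟩)
    rw [← real_inner_smul_right, smul_sub, hup, hup] at h1
    set a : ℝ := 1 / ((n : ℝ) + 1)
    set b : ℝ := 1 / ((m : ℝ) + 1)
    have hb : 0 < b := by positivity
    have hab : b < a := Nat.one_div_lt_one_div hlt
    have h2 := norm_sub_sq_real (p m) (p n)
    simp only [inner_sub_left, inner_sub_right, inner_neg_right, real_inner_smul_right,
      real_inner_self_eq_norm_sq] at h1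
    rw [real_inner_comm (p m) (p n)] at h1
    rw [h2]
    nlinarith [sq_nonneg ‖p m - p n‖]
  have hmono : Monotone fun n => ‖p n‖ ^ 2 := fun n m hnm => by
    have := hdiff n m hnm
    have := sq_nonneg ‖p m - p n‖
    simp only
    linarith
  have hconv : Tendsto (fun n => ‖p n‖ ^ 2) atTop (𝓝 (⨆ n, ‖p n‖ ^ 2)) :=
    tendsto_atTop_ciSup hmono ⟨R ^ 2, by
      rintro _ ⟨n, rfl⟩
      exact pow_le_pow_left₀ (norm_nonneg _) (hpR n) 2⟩
  have hcauchy : CauchySeq p := by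
    refine Metric.cauchySeq_iff'.2 fun ε hε => ?_
    obtain ⟨N, hN⟩ := Metric.cauchySeq_iff'.1 hconv.cauchySeq (ε ^ 2) (by positivity)
    refine ⟨N, fun n hn => ?_⟩
    rw [dist_eq_norm]
    refine lt_of_pow_lt_pow_left₀ 2 hε.le ((hdiff N n hn).trans_lt ?_)
    exact (le_abs_self _).trans_lt (hN n hn)
  obtain ⟨x, hx⟩ := cauchySeq_tendsto_of_complete hcauchy
  refine ⟨x, hA.mem_zer_of_tendsto hB hBm hu hpR (fun h => hx.inner tendsto_const_nhds) ?_⟩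
  have h1 : ∀ n, u n + B (p n) = (c : ℝ)⁻¹ • -((1 / ((n : ℝ) + 1)) • p n) := fun n => by
    rw [← hup, inv_smul_smul₀ hc'.ne']
  simp only [h1]
  simpa using ((tendsto_one_div_add_atTop_nhds_zero_nat (𝕜 := ℝ)).smul hx).neg.const_smul
    (c : ℝ)⁻¹

end SetValued

/-! ### An almost supermartingale convergence theorem -/

section RobbinsSiegmund

variable {Ω H : Type*} [NormedAddCommGroup H] [InnerProductSpace ℝ H]

/-- On a set known in advance where the coefficient `c` is bounded, the linear noise term `⟪c, e⟫`
has mean zero. -/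
theorem integrableOn_inner_and_setIntegral_eq_zero [CompleteSpace H] {m m0 : MeasurableSpace Ω}
    (hm : m ≤ m0) {P : Measure Ω} [IsFiniteMeasure P] {c e : Ω → H} (hc : StronglyMeasurable[m] c)
    (he : Integrable e P) (he0 : P[e | m] =ᵐ[P] 0) {s : Set Ω} (hs : MeasurableSet[m] s) {R : ℝ}
    (hR : ∀ ω ∈ s, ‖c ω‖ ≤ R) :
    IntegrableOn (fun ω => inner ℝ (c ω) (e ω)) s P ∧ ∫ ω in s, inner ℝ (c ω) (e ω) ∂P = 0 := by
  have hc' : StronglyMeasurable[m] (s.indicator c) := hc.indicator hs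
  have hb : ∀ ω, ‖s.indicator c ω‖ ≤ |R| := by
    intro ω
    by_cases h : ω ∈ s
    · rw [Set.indicator_of_mem h]
      exact (hR ω h).trans (le_abs_self R)
    · rw [Set.indicator_of_notMem h, norm_zero]
      exact abs_nonneg R
  have heq : (fun ω => inner ℝ (s.indicator c ω) (e ω))
      = s.indicator fun ω => inner ℝ (c ω) (e ω) := by
    ext ω
    by_cases h : ω ∈ s <;> simp [h]
  have hint : Integrable (fun ω => inner ℝ (s.indicator c ω) (e ω)) P := by
    refine (he.norm.const_mul |R|).mono'
      ((hc'.mono hm).aestronglyMeasurable.inner he.aestronglyMeasurable) (ae_of_all _ fun ω => ?_)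
    exact (norm_inner_le_norm _ _).trans (mul_le_mul_of_nonneg_right (hb ω) (norm_nonneg _))
  have hcond : P[fun ω => inner ℝ (s.indicator c ω) (e ω) | m] =ᵐ[P] 0 := by
    have h := condExp_bilin_of_stronglyMeasurable_left (innerSL ℝ) hc' hint he
    filter_upwards [h, he0] with ω h1 h2
    rw [h2, Pi.zero_apply, map_zero] at h1
    exact h1
  refine ⟨?_, ?_⟩
  · rw [heq] at hint
    exact (integrable_indicator_iff (hm s hs)).1 hint
  · rw [← integral_indicator (hm s hs), ← heq, ← integral_condExp hm, integral_congr_ae hcond]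
    simp

/-- The conditional mean of the noise `e` vanishes, so a pathwise descent inequality with an error
term `⟪c, e⟫`, where `c` is known in advance, holds without that term after integration over any
set known in advance. No integrability of `c` or of `⟪c, e⟫` is needed. -/
theorem setLIntegral_add_le_of_ae_le_add_inner [CompleteSpace H] {m m0 : MeasurableSpace Ω}
    (hm : m ≤ m0) {P : Measure Ω} [IsFiniteMeasure P] {c e : Ω → H} (hc : StronglyMeasurable[m] c)
    (he : Integrable e P) (he0 : P[e | m] =ᵐ[P] 0) {V U : Ω → ℝ}
    (hVm : AEStronglyMeasurable V P) (hV0 : 0 ≤ᵐ[P] V) (hU0 : 0 ≤ᵐ[P] U)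
    (hle : ∀ᵐ ω ∂P, U ω ≤ V ω + inner ℝ (c ω) (e ω)) {s : Set Ω} (hs : MeasurableSet[m] s) :
    ∫⁻ ω in s, ENNReal.ofReal (U ω) ∂P ≤ ∫⁻ ω in s, ENNReal.ofReal (V ω) ∂P := by
  set t : ℕ → Set Ω := fun j => s ∩ {ω | ‖c ω‖ ≤ j}
  have ht : ∀ j, MeasurableSet[m] (t j) := fun j =>
    hs.inter (hc.norm.measurable measurableSet_Iic)
  have hmono : Monotone t := fun i j hij ω hω =>
    ⟨hω.1, le_trans (show ‖c ω‖ ≤ i from hω.2) (Nat.cast_le.2 hij)⟩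
  have hU : s = ⋃ j, t j := by
    rw [← Set.inter_iUnion, Set.left_eq_inter]
    intro ω _
    exact Set.mem_iUnion.2 (exists_nat_ge ‖c ω‖)
  have key : ∀ j, ∫⁻ ω in t j, ENNReal.ofReal (U ω) ∂P ≤ ∫⁻ ω in s, ENNReal.ofReal (V ω) ∂P := by
    intro j
    refine le_trans ?_ (lintegral_mono_set Set.inter_subset_left :
      ∫⁻ ω in t j, ENNReal.ofReal (V ω) ∂P ≤ _)
    by_cases hfin : ∫⁻ ω in t j, ENNReal.ofReal (V ω) ∂P = ∞
    · rw [hfin]; exact le_top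
    have hVint : IntegrableOn V (t j) P := by
      rw [IntegrableOn, ← lintegral_ofReal_ne_top_iff_integrable hVm.restrict
        (ae_restrict_of_ae hV0)]
      exact hfin
    obtain ⟨hi, hz⟩ := integrableOn_inner_and_setIntegral_eq_zero hm hc he he0 (ht j)
      (R := j) fun ω hω => hω.2
    have h1 : ∫⁻ ω in t j, ENNReal.ofReal (U ω) ∂P
        ≤ ∫⁻ ω in t j, ENNReal.ofReal (V ω + inner ℝ (c ω) (e ω)) ∂P := by
      refine lintegral_mono_ae (ae_restrict_of_ae ?_)
      filter_upwards [hle] with ω hω using ENNReal.ofReal_le_ofReal hω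
    have h0 : 0 ≤ᵐ[P.restrict (t j)] fun ω => V ω + inner ℝ (c ω) (e ω) := by
      refine ae_restrict_of_ae ?_
      filter_upwards [hle, hU0] with ω h2 h3 using h3.trans h2
    refine h1.trans (le_of_eq ?_)
    rw [← ofReal_integral_eq_lintegral_ofReal (f := fun ω => V ω + inner ℝ (c ω) (e ω))
        (hVint.add hi) h0,
      ← ofReal_integral_eq_lintegral_ofReal hVint (ae_restrict_of_ae hV0),
      integral_add hVint hi, hz, add_zero]
  rw [hU, setLIntegral_iUnion_of_directed _ (hmono.directed_le)]
  exact iSup_le fun j => (key j).trans (by rw [← hU])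

/-- Convergence of a nonnegative almost supermartingale `V` with errors `p` and decrements `θ`
on the event that no localizing set `S n` is left. -/
theorem ae_tendsto_of_setLIntegral_add_le {m0 : MeasurableSpace Ω} {P : Measure Ω}
    [IsFiniteMeasure P] {ℱ : Filtration ℕ m0} {V : ℕ → Ω → ℝ} {θ p : ℕ → Ω → ℝ≥0∞} {S : ℕ → Set Ω}
    (hV : ∀ n, StronglyMeasurable[ℱ n] (V n)) (hV0 : ∀ n ω, 0 ≤ V n ω)
    (hθ : ∀ n, AEMeasurable (θ n) P) (hp : ∀ n, AEMeasurable (p n) P)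
    (hS : ∀ n, MeasurableSet[ℱ n] (S n)) (hSanti : Antitone S)
    (hV0int : ∫⁻ ω in S 0, ENNReal.ofReal (V 0 ω) ∂P ≠ ∞)
    (hpint : ∑' n, ∫⁻ ω in S n, p n ω ∂P ≠ ∞)
    (hstep : ∀ n s, MeasurableSet[ℱ n] s →
      ∫⁻ ω in s, (ENNReal.ofReal (V (n + 1) ω) + θ n ω) ∂P
        ≤ ∫⁻ ω in s, (ENNReal.ofReal (V n ω) + p n ω) ∂P) :
    ∀ᵐ ω ∂P, (∀ n, ω ∈ S n) →
      (∃ l, Tendsto (fun n => V n ω) atTop (𝓝 l)) ∧ ∑' n, θ n ω ≠ ∞ := by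
  have hSm : ∀ n, MeasurableSet (S n) := fun n => ℱ.le n _ (hS n)
  have hVm : ∀ n, Measurable fun ω => ENNReal.ofReal (V n ω) := fun n =>
    ((hV n).mono (ℱ.le n)).measurable.ennreal_ofReal
  set M := ∫⁻ ω in S 0, ENNReal.ofReal (V 0 ω) ∂P + ∑' n, ∫⁻ ω in S n, p n ω ∂P
  have hMtop : M ≠ ∞ := ENNReal.add_ne_top.2 ⟨hV0int, hpint⟩
  have hbound : ∀ n, ∫⁻ ω in S n, ENNReal.ofReal (V n ω) ∂P
      + ∑ k ∈ Finset.range n, ∫⁻ ω in S k, θ k ω ∂P ≤ M := by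
    intro n
    refine le_trans ?_ (add_le_add_right
      (ENNReal.sum_le_tsum (f := fun n => ∫⁻ ω in S n, p n ω ∂P) (Finset.range n)) _)
    induction n with
    | zero => simp
    | succ n ih =>
      have h1 := hstep n (S n) (hS n)
      rw [lintegral_add_left (hVm _), lintegral_add_left (hVm _)] at h1
      have h2 : ∫⁻ ω in S (n + 1), ENNReal.ofReal (V (n + 1) ω) ∂P
          ≤ ∫⁻ ω in S n, ENNReal.ofReal (V (n + 1) ω) ∂P :=
        lintegral_mono_set (hSanti n.le_succ)
      rw [Finset.sum_range_succ, Finset.sum_range_succ]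
      calc _ ≤ (∫⁻ ω in S n, ENNReal.ofReal (V (n + 1) ω) ∂P + ∫⁻ ω in S n, θ n ω ∂P)
            + ∑ k ∈ Finset.range n, ∫⁻ ω in S k, θ k ω ∂P := by
            rw [add_comm (∑ k ∈ Finset.range n, _), ← add_assoc]
            gcongr
        _ ≤ _ := by
            refine (add_le_add_left h1 _).trans ?_
            rw [add_right_comm, ← add_assoc]
            exact add_le_add_left ih _
  have hθsum : ∀ᵐ ω ∂P, ∑' n, (S n).indicator (θ n) ω ≠ ∞ := by
    have h1 : ∫⁻ ω, ∑' n, (S n).indicator (θ n) ω ∂P ≤ M := by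
      rw [lintegral_tsum fun n => (hθ n).indicator (hSm n)]
      simp only [lintegral_indicator (hSm _)]
      rw [ENNReal.tsum_eq_iSup_nat]
      exact iSup_le fun n => le_add_self.trans (hbound n)
    filter_upwards [ae_lt_top' (AEMeasurable.tsum fun n => (hθ n).indicator (hSm n))
      (ne_top_of_le_ne_top hMtop h1)] with ω hω using hω.ne
  -- `W` is the localized process, compensated by the conditional expectations of the errors.
  set Z : ℕ → Ω → ℝ := fun n => (S n).indicator (V n)
  set q : ℕ → Ω → ℝ := fun n ω => ((S n).indicator (p n) ω).toReal
  set g : ℕ → Ω → ℝ := fun n => P[q n | ℱ n]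
  set W : ℕ → Ω → ℝ := fun n => Z n - ∑ k ∈ Finset.range n, g k
  have hZ0 : ∀ n ω, 0 ≤ Z n ω := fun n ω => Set.indicator_nonneg (fun ω _ => hV0 n ω) ω
  have hZm : ∀ n, StronglyMeasurable[ℱ n] (Z n) := fun n => (hV n).indicator (hS n)
  have hZlint : ∀ n s, MeasurableSet s → ∫⁻ ω in s, ENNReal.ofReal (Z n ω) ∂P
      = ∫⁻ ω in s ∩ S n, ENNReal.ofReal (V n ω) ∂P := by
    intro n s hs
    rw [Set.inter_comm, ← setLIntegral_indicator (hSm n)]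
    refine lintegral_congr fun ω => ?_
    by_cases h : ω ∈ S n <;> simp [Z, h]
  have hZle : ∀ n, ∫⁻ ω, ENNReal.ofReal (Z n ω) ∂P ≤ M := by
    intro n
    rw [← setLIntegral_univ, hZlint n _ .univ, Set.univ_inter]
    exact le_self_add.trans (hbound n)
  have hZint : ∀ n, Integrable (Z n) P := fun n =>
    (lintegral_ofReal_ne_top_iff_integrable ((hZm n).mono (ℱ.le n)).aestronglyMeasurable
      (ae_of_all _ (hZ0 n))).1 (ne_top_of_le_ne_top hMtop (hZle n))
  have hpfin : ∀ n, ∫⁻ ω, (S n).indicator (p n) ω ∂P ≠ ∞ := fun n => by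
    rw [lintegral_indicator (hSm n)]
    exact ENNReal.ne_top_of_tsum_ne_top hpint n
  have hqint : ∀ n, Integrable (q n) P := fun n =>
    integrable_toReal_of_lintegral_ne_top ((hp n).indicator (hSm n)) (hpfin n)
  have hqlint : ∀ n, (fun ω => ENNReal.ofReal (q n ω)) =ᵐ[P] (S n).indicator (p n) := fun n => by
    filter_upwards [ae_lt_top' ((hp n).indicator (hSm n)) (hpfin n)] with ω hω
    exact ENNReal.ofReal_toReal hω.ne
  have hgint : ∀ n, Integrable (g n) P := fun n => integrable_condExp
  have hgnorm : ∀ n, eLpNorm (g n) 1 P ≤ ∫⁻ ω in S n, p n ω ∂P := by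
    intro n
    refine (eLpNorm_condExp_le_eLpNorm _ le_rfl).trans (le_of_eq ?_)
    rw [eLpNorm_one_eq_lintegral_enorm, ← lintegral_indicator (hSm n)]
    refine lintegral_congr_ae ?_
    filter_upwards [hqlint n] with ω hω
    rw [← hω, Real.enorm_of_nonneg ENNReal.toReal_nonneg]
  have hW : Supermartingale W ℱ P := by
    refine supermartingale_of_setIntegral_succ_le (fun n => ?_) (fun n => ?_) fun n s hs => ?_
    · refine (hZm n).sub (Finset.stronglyMeasurable_sum _ fun k hk => ?_)
      exact stronglyMeasurable_condExp.mono (ℱ.mono (Finset.mem_range.1 hk).le)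
    · exact (hZint n).sub (integrable_finsetSum' _ fun k _ => hgint k)
    · have hsm : MeasurableSet s := ℱ.le n s hs
      have hsum : ∀ n, IntegrableOn (∑ k ∈ Finset.range n, g k) s P := fun n =>
        (integrable_finsetSum' _ fun k _ => hgint k).integrableOn
      have key : ∫ ω in s, Z (n + 1) ω ∂P ≤ ∫ ω in s, Z n ω ∂P + ∫ ω in s, q n ω ∂P := by
        rw [← integral_add (hZint n).integrableOn (hqint n).integrableOn,
          integral_eq_lintegral_of_nonneg_ae (ae_of_all _ (hZ0 _))
            (hZint _).aestronglyMeasurable.restrict,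
          integral_eq_lintegral_of_nonneg_ae
            (ae_of_all _ fun ω => add_nonneg (hZ0 n ω) ENNReal.toReal_nonneg)
            ((hZint n).add (hqint n)).aestronglyMeasurable.restrict]
        refine ENNReal.toReal_mono ?_ ?_
        · exact (((hZint n).add (hqint n)).integrableOn.lintegral_lt_top).ne
        · have h1 := hstep n (s ∩ S n) (hs.inter (hS n))
          have h2 : ∫⁻ ω in s, ENNReal.ofReal (Z n ω + q n ω) ∂P
              = ∫⁻ ω in s ∩ S n, (ENNReal.ofReal (V n ω) + p n ω) ∂P := by
            rw [lintegral_add_left (hVm n), ← hZlint n s hsm]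
            have h3 : ∫⁻ ω in s ∩ S n, p n ω ∂P = ∫⁻ ω in s, ENNReal.ofReal (q n ω) ∂P := by
              rw [Set.inter_comm, ← setLIntegral_indicator (hSm n)]
              exact lintegral_congr_ae (ae_restrict_of_ae (hqlint n).symm)
            rw [h3, ← lintegral_add_left (((hZm n).mono (ℱ.le n)).measurable.ennreal_ofReal)]
            refine lintegral_congr fun ω => ENNReal.ofReal_add (hZ0 n ω) ENNReal.toReal_nonneg
          rw [h2, hZlint _ _ hsm]
          refine le_trans ?_ h1
          refine (lintegral_mono_set (Set.inter_subset_inter_right s (hSanti n.le_succ))).trans ?_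
          exact lintegral_mono fun ω => le_self_add
      simp only [W, Pi.sub_apply]
      rw [integral_sub (hZint _).integrableOn (hsum _), integral_sub (hZint _).integrableOn
        (hsum _), Finset.sum_range_succ, integral_add' (hsum _) (hgint _).integrableOn,
        setIntegral_condExp (ℱ.le n) (hqint n) hs]
      linarith
  have hsumg : ∑' k, eLpNorm (g k) 1 P ≤ M :=
    (ENNReal.tsum_le_tsum hgnorm).trans le_add_self
  have hWbdd : ∀ n, eLpNorm ((-W) n) 1 P ≤ (2 * M).toNNReal := by
    intro n
    rw [ENNReal.coe_toNNReal (ENNReal.mul_ne_top (by simp) hMtop), Pi.neg_apply, eLpNorm_neg,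
      two_mul]
    refine (eLpNorm_sub_le (hZint n).aestronglyMeasurable
      (integrable_finsetSum' _ fun k _ => hgint k).aestronglyMeasurable le_rfl).trans
      (add_le_add ?_ ?_)
    · rw [eLpNorm_one_eq_lintegral_enorm]
      simpa only [Real.enorm_of_nonneg (hZ0 n _)] using hZle n
    · refine (eLpNorm_sum_le (fun k _ => (hgint k).aestronglyMeasurable) le_rfl).trans ?_
      exact (ENNReal.sum_le_tsum _).trans hsumg
  have hgsum : ∀ᵐ ω ∂P, Summable fun k => g k ω := by
    have h1 : ∫⁻ ω, ∑' k, ‖g k ω‖ₑ ∂P ≤ M := by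
      rw [lintegral_tsum fun k => (hgint k).aestronglyMeasurable.enorm]
      simpa only [eLpNorm_one_eq_lintegral_enorm] using hsumg
    filter_upwards [ae_lt_top' (AEMeasurable.tsum fun n =>
      (hgint n).aestronglyMeasurable.enorm) (ne_top_of_le_ne_top hMtop h1)] with ω hω
    exact Summable.of_nnnorm (ENNReal.tsum_coe_ne_top_iff_summable.1 hω.ne)
  filter_upwards [hθsum, hgsum, hW.neg.exists_ae_tendsto_of_bdd hWbdd] with ω h1 h2 ⟨l, h3⟩ hmem
  refine ⟨⟨_, (h3.neg.add h2.hasSum.tendsto_sum_nat).congr fun n => ?_⟩, ?_⟩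
  · simp [W, Z, hmem n]
  · simpa only [Set.indicator_of_mem (hmem _)] using h1

/-- The event that the first `n + 1` terms of the nonnegative series `∑ v` add up to at most `K`. -/
def partialSumsLe (v : ℕ → Ω → ℝ≥0∞) (K : ℝ≥0∞) (n : ℕ) : Set Ω :=
  {ω | ∑ k ∈ Finset.range (n + 1), v k ω ≤ K}

theorem antitone_partialSumsLe (v : ℕ → Ω → ℝ≥0∞) (K : ℝ≥0∞) : Antitone (partialSumsLe v K) :=
  fun _ _ hij _ hω =>
    le_trans (Finset.sum_le_sum_of_subset (Finset.range_subset_range.2 (Nat.succ_le_succ hij)))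
      (show _ ≤ K from hω)

theorem measurableSet_partialSumsLe {m0 : MeasurableSpace Ω} {ℱ : Filtration ℕ m0}
    {v : ℕ → Ω → ℝ≥0∞} (hv : ∀ n, Measurable[ℱ n] (v n)) (K : ℝ≥0∞) (n : ℕ) :
    MeasurableSet[ℱ n] (partialSumsLe v K n) :=
  (Finset.measurable_sum _ fun k hk =>
    (hv k).mono (ℱ.mono (Nat.lt_succ_iff.1 (Finset.mem_range.1 hk))) le_rfl) measurableSet_Iic

theorem tsum_indicator_partialSumsLe_le (v : ℕ → Ω → ℝ≥0∞) (K : ℝ≥0∞) (ω : Ω) :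
    ∑' n, (partialSumsLe v K n).indicator (v n) ω ≤ K := by
  rw [ENNReal.tsum_eq_iSup_nat]
  refine iSup_le fun n => ?_
  induction n with
  | zero => simp
  | succ n ih =>
    rw [Finset.sum_range_succ]
    by_cases h : ω ∈ partialSumsLe v K n
    · refine le_trans ?_ (show ∑ k ∈ Finset.range (n + 1), v k ω ≤ K from h)
      rw [Finset.sum_range_succ]
      exact add_le_add (Finset.sum_le_sum fun k _ => Set.indicator_le_self _ _ _)
        (Set.indicator_le_self _ _ _)
    · simpa [h] using ih

/-- If the conditional expectations of the nonnegative `f n` are `v n`, then the `f n`, localized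
to the events on which the partial sums of `v` are at most `K`, have total expectation at most
`K`. -/
theorem tsum_setLIntegral_partialSumsLe_le {m0 : MeasurableSpace Ω} {P : Measure Ω}
    [IsFiniteMeasure P] {ℱ : Filtration ℕ m0} {f v : ℕ → Ω → ℝ≥0∞}
    (hv : ∀ n, Measurable[ℱ n] (v n))
    (hfv : ∀ n s, MeasurableSet[ℱ n] s → ∫⁻ ω in s, f n ω ∂P = ∫⁻ ω in s, v n ω ∂P) (K : ℝ≥0∞) :
    ∑' n, ∫⁻ ω in partialSumsLe v K n, f n ω ∂P ≤ K * P Set.univ := by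
  have hS := measurableSet_partialSumsLe hv K
  simp only [hfv _ _ (hS _), ← lintegral_indicator (ℱ.le _ _ (hS _))]
  rw [← lintegral_tsum fun n =>
    (((hv n).mono (ℱ.le n) le_rfl).indicator (ℱ.le _ _ (hS n))).aemeasurable]
  exact (lintegral_mono (tsum_indicator_partialSumsLe_le v K)).trans (by simp)

theorem exists_nat_forall_mem_partialSumsLe {v : ℕ → Ω → ℝ≥0∞} {ω : Ω} (h : ∑' n, v n ω ≠ ∞) :
    ∃ K : ℕ, ∀ n, ω ∈ partialSumsLe v K n := by
  obtain ⟨K, hK⟩ := ENNReal.exists_nat_gt h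
  exact ⟨K, fun n => (ENNReal.sum_le_tsum _).trans hK.le⟩

/-- A nonnegative series converges almost surely if the series of its conditional expectations
does. -/
theorem ae_tsum_ne_top_of_condLExp {m0 : MeasurableSpace Ω} {P : Measure Ω}
    [IsFiniteMeasure P] {ℱ : Filtration ℕ m0} {f v : ℕ → Ω → ℝ≥0∞}
    (hf : ∀ n, AEMeasurable (f n) P) (hv : ∀ n, Measurable[ℱ n] (v n))
    (hfv : ∀ n s, MeasurableSet[ℱ n] s → ∫⁻ ω in s, f n ω ∂P = ∫⁻ ω in s, v n ω ∂P)
    (hsum : ∀ᵐ ω ∂P, ∑' n, v n ω ≠ ∞) : ∀ᵐ ω ∂P, ∑' n, f n ω ≠ ∞ := by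
  have hloc : ∀ K : ℕ, ∀ᵐ ω ∂P, ∑' n, (partialSumsLe v K n).indicator (f n) ω ≠ ∞ := by
    intro K
    have hS := fun n => ℱ.le _ _ (measurableSet_partialSumsLe hv K n)
    have h1 : ∫⁻ ω, ∑' n, (partialSumsLe v K n).indicator (f n) ω ∂P ≠ ∞ := by
      rw [lintegral_tsum fun n => (hf n).indicator (hS n)]
      simp only [lintegral_indicator (hS _)]
      exact ne_top_of_le_ne_top (ENNReal.mul_ne_top (ENNReal.natCast_ne_top K)
        (measure_ne_top P _)) (tsum_setLIntegral_partialSumsLe_le hv hfv K)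
    filter_upwards [ae_lt_top' (AEMeasurable.tsum fun n => (hf n).indicator (hS n)) h1]
      with ω hω using hω.ne
  filter_upwards [hsum, ae_all_iff.2 hloc] with ω h1 h2
  obtain ⟨K, hK⟩ := exists_nat_forall_mem_partialSumsLe h1
  simpa only [Set.indicator_of_mem (hK _)] using h2 K

/-- **Robbins–Siegmund** for a descent inequality perturbed by unbiased noise `e`. The error at
step `n` may involve the squared noise of two consecutive steps; the conditional variances of the
noise are only assumed almost surely summable. -/
theorem ae_tendsto_and_tsum_ne_top_of_noisy_descent [CompleteSpace H] {m0 : MeasurableSpace Ω}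
    {P : Measure Ω} [IsFiniteMeasure P] {ℱ : Filtration ℕ m0} {e c : ℕ → Ω → H}
    (he : ∀ n, Integrable (e n) P) (he0 : ∀ n, P[e n | ℱ n] =ᵐ[P] 0) {β b : ℕ → ℝ}
    (hβ : ∀ n, 0 ≤ β n) (hb : ∀ n, 0 ≤ b n) (hbsum : Summable b)
    (hvar : ∀ᵐ ω ∂P,
      ∑' n, ENNReal.ofReal (β n) * condLExp (ℱ n) P (fun ω => ‖e n ω‖ₑ ^ 2) ω ≠ ∞)
    (hc : ∀ n, StronglyMeasurable[ℱ (n + 1)] (c n)) {V θ : ℕ → Ω → ℝ}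
    (hV : ∀ n, StronglyMeasurable[ℱ (n + 1)] (V n)) (hV0 : ∀ n ω, 0 ≤ V n ω)
    (hθ : ∀ n, AEStronglyMeasurable (θ n) P) (hθ0 : ∀ n, 0 ≤ᵐ[P] θ n)
    (hstep : ∀ n, ∀ᵐ ω ∂P, V (n + 1) ω + θ n ω ≤ V n ω + b n + β (n + 1) * ‖e (n + 1) ω‖ ^ 2
      + β n * ‖e n ω‖ ^ 2 + inner ℝ (c n ω) (e (n + 1) ω)) :
    ∀ᵐ ω ∂P, (∃ l, Tendsto (fun n => V n ω) atTop (𝓝 l)) ∧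
      ∑' n, ENNReal.ofReal (θ n ω) ≠ ∞ ∧ Summable fun n => β n * ‖e n ω‖ ^ 2 := by
  set f : ℕ → Ω → ℝ≥0∞ := fun n ω => ENNReal.ofReal (β n) * ‖e n ω‖ₑ ^ 2
  set v : ℕ → Ω → ℝ≥0∞ := fun n ω =>
    ENNReal.ofReal (β n) * condLExp (ℱ n) P (fun ω => ‖e n ω‖ₑ ^ 2) ω
  have hf_eq : ∀ n ω, f n ω = ENNReal.ofReal (β n * ‖e n ω‖ ^ 2) := fun n ω => by
    rw [ENNReal.ofReal_mul (hβ n), ENNReal.ofReal_pow (norm_nonneg _), ofReal_norm]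
  have hf : ∀ n, AEMeasurable (f n) P := fun n =>
    ((he n).aestronglyMeasurable.enorm.pow_const 2).const_mul _
  have hv : ∀ n, Measurable[ℱ n] (v n) := fun n => (measurable_condLExp _ _ _).const_mul _
  have hfv : ∀ n s, MeasurableSet[ℱ n] s → ∫⁻ ω in s, f n ω ∂P = ∫⁻ ω in s, v n ω ∂P := by
    intro n s hs
    rw [lintegral_const_mul' _ _ ENNReal.ofReal_ne_top,
      lintegral_const_mul' _ _ ENNReal.ofReal_ne_top, setLIntegral_condLExp (ℱ.le n) P _ hs]
  have hfsum := ae_tsum_ne_top_of_condLExp hf hv hfv hvar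
  set 𝒢 : Filtration ℕ m0 :=
    ⟨fun n => ℱ (n + 1), fun i j hij => ℱ.mono (by lia), fun n => ℱ.le _⟩
  set p : ℕ → Ω → ℝ≥0∞ := fun n ω => ENNReal.ofReal (b n) + (f (n + 1) ω + f n ω) with hp_def
  have hp : ∀ n, AEMeasurable (p n) P := fun n => ((hf _).add (hf n)).const_add _
  have hp_eq : ∀ n ω, p n ω
      = ENNReal.ofReal (b n + β (n + 1) * ‖e (n + 1) ω‖ ^ 2 + β n * ‖e n ω‖ ^ 2) := by
    intro n ω
    have h1 := mul_nonneg (hβ (n + 1)) (sq_nonneg ‖e (n + 1) ω‖)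
    have h2 := mul_nonneg (hβ n) (sq_nonneg ‖e n ω‖)
    rw [ENNReal.ofReal_add (add_nonneg (hb n) h1) h2, ENNReal.ofReal_add (hb n) h1, ← hf_eq,
      ← hf_eq, add_assoc]
  have hstep' : ∀ n s, MeasurableSet[𝒢 n] s →
      ∫⁻ ω in s, (ENNReal.ofReal (V (n + 1) ω) + ENNReal.ofReal (θ n ω)) ∂P
        ≤ ∫⁻ ω in s, (ENNReal.ofReal (V n ω) + p n ω) ∂P := by
    intro n s hs
    have h1 := setLIntegral_add_le_of_ae_le_add_inner (P := P) (ℱ.le (n + 1)) (hc n) (he (n + 1))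
      (he0 (n + 1)) (U := fun ω => V (n + 1) ω + θ n ω)
      (V := fun ω => V n ω + (b n + β (n + 1) * ‖e (n + 1) ω‖ ^ 2 + β n * ‖e n ω‖ ^ 2))
      ?_ ?_ ?_ ?_ hs
    · refine le_trans (le_of_eq (lintegral_congr_ae ?_))
        (h1.trans (le_of_eq (lintegral_congr fun ω => ?_)))
      · filter_upwards [ae_restrict_of_ae (hθ0 n)] with ω hω
        exact (ENNReal.ofReal_add (hV0 _ ω) hω).symm
      · rw [hp_eq, ENNReal.ofReal_add (hV0 n ω)]
        have h1 := mul_nonneg (hβ (n + 1)) (sq_nonneg ‖e (n + 1) ω‖)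
        have h2 := mul_nonneg (hβ n) (sq_nonneg ‖e n ω‖)
        linarith [hb n]
    · exact ((hV n).mono (ℱ.le _)).aestronglyMeasurable.add ((aestronglyMeasurable_const.add
        (((he _).aestronglyMeasurable.norm.pow 2).const_mul _)).add
        (((he _).aestronglyMeasurable.norm.pow 2).const_mul _))
    · refine ae_of_all _ fun ω => ?_
      have h0 := hV0 n ω
      have h1 := mul_nonneg (hβ (n + 1)) (sq_nonneg ‖e (n + 1) ω‖)
      have h2 := mul_nonneg (hβ n) (sq_nonneg ‖e n ω‖)
      have h3 := hb n
      simp only [Pi.zero_apply]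
      linarith
    · filter_upwards [hθ0 n] with ω hω using add_nonneg (hV0 _ ω) hω
    · filter_upwards [hstep n] with ω hω
      linarith
  have hloc : ∀ K : ℕ, ∀ᵐ ω ∂P,
      (∀ n, ω ∈ partialSumsLe v K (n + 1) ∩ {ω | V 0 ω ≤ K}) →
      (∃ l, Tendsto (fun n => V n ω) atTop (𝓝 l)) ∧ ∑' n, ENNReal.ofReal (θ n ω) ≠ ∞ := by
    intro K
    refine ae_tendsto_of_setLIntegral_add_le (ℱ := 𝒢) (p := p) hV hV0
      (fun n => (hθ n).aemeasurable.ennreal_ofReal) hp (fun n => ?_) (fun i j hij => ?_) ?_ ?_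
      hstep'
    · exact (measurableSet_partialSumsLe hv K (n + 1)).inter
        (((hV 0).mono (ℱ.mono (by lia))).measurable measurableSet_Iic)
    · exact Set.inter_subset_inter_left _ (antitone_partialSumsLe v K (by lia))
    · refine ne_top_of_le_ne_top (ENNReal.mul_ne_top (ENNReal.natCast_ne_top K)
        (measure_ne_top P Set.univ)) ?_
      refine (setLIntegral_mono (g := fun _ => (K : ℝ≥0∞)) measurable_const fun ω hω => ?_).trans ?_
      · exact (ENNReal.ofReal_le_ofReal hω.2).trans (by simp)
      · rw [setLIntegral_const]
        exact mul_le_mul_right (measure_mono (Set.subset_univ _)) _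
    · have hK := tsum_setLIntegral_partialSumsLe_le hv hfv (K : ℝ≥0∞)
      have hKtop : (K : ℝ≥0∞) * P Set.univ ≠ ∞ :=
        ENNReal.mul_ne_top (ENNReal.natCast_ne_top K) (measure_ne_top P _)
      refine ne_top_of_le_ne_top (b := ∑' n, (ENNReal.ofReal (b n) * P Set.univ
        + (∫⁻ ω in partialSumsLe v K (n + 1), f (n + 1) ω ∂P
        + ∫⁻ ω in partialSumsLe v K n, f n ω ∂P))) ?_ (ENNReal.tsum_le_tsum fun n => ?_)
      · rw [ENNReal.tsum_add, ENNReal.tsum_add, ENNReal.tsum_mul_right,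
          ← ENNReal.ofReal_tsum_of_nonneg hb hbsum]
        refine ENNReal.add_ne_top.2 ⟨ENNReal.mul_ne_top ENNReal.ofReal_ne_top (measure_ne_top P _),
          ENNReal.add_ne_top.2 ⟨ne_top_of_le_ne_top hKtop (le_trans ?_ hK),
            ne_top_of_le_ne_top hKtop hK⟩⟩
        exact ENNReal.tsum_comp_le_tsum_of_injective (add_left_injective 1) _
      · rw [hp_def, lintegral_add_left measurable_const, lintegral_add_left' (hf _).restrict,
          setLIntegral_const]
        refine add_le_add (mul_le_mul_right (measure_mono (Set.subset_univ _)) _)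
          (add_le_add (lintegral_mono_set Set.inter_subset_left) (lintegral_mono_set ?_))
        exact Set.inter_subset_left.trans (antitone_partialSumsLe v K n.le_succ)
  filter_upwards [hvar, hfsum, ae_all_iff.2 hloc] with ω h1 h2 h3
  obtain ⟨K, hK⟩ := exists_nat_forall_mem_partialSumsLe h1
  obtain ⟨L, hL⟩ := exists_nat_ge (V 0 ω)
  have h4 := h3 (max K L) fun n =>
    ⟨le_trans (show _ ≤ (K : ℝ≥0∞) from hK (n + 1)) (Nat.cast_le.2 (le_max_left K L)),
      hL.trans (Nat.cast_le.2 (le_max_right K L))⟩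
  refine ⟨h4.1, h4.2, ?_⟩
  simp only [hf_eq] at h2
  have h5 := ENNReal.summable_toReal h2
  simpa only [ENNReal.toReal_ofReal (mul_nonneg (hβ _) (sq_nonneg _))] using h5

end RobbinsSiegmund

/-! ### Weak convergence in Hilbert spaces -/

section WeakConvergence

variable {H : Type*} [NormedAddCommGroup H] [InnerProductSpace ℝ H]

theorem tendsto_toWeakSpace_of_forall_inner [CompleteSpace H] {ι : Type*} {l : Filter ι} {x : ι → H}
    {a : H} (h : ∀ v, Tendsto (fun i => inner ℝ (x i) v) l (𝓝 (inner ℝ a v))) :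
    Tendsto (fun i => toWeakSpace ℝ H (x i)) l (𝓝 (toWeakSpace ℝ H a)) := by
  refine (WeakBilin.tendsto_iff_forall_eval_tendsto _ ?_).2 fun f => ?_
  · intro y z hyz
    refine ext_inner_left ℝ fun v => ?_
    exact LinearMap.congr_fun hyz (innerSL ℝ v)
  · obtain ⟨v, rfl⟩ := (InnerProductSpace.toDual ℝ H).surjective f
    have h1 := h v
    simp only [real_inner_comm v] at h1
    exact h1

/-- Weak compactness of closed balls, along an ultrafilter. -/
theorem exists_forall_tendsto_inner_of_norm_le [CompleteSpace H] {ι : Type*} (U : Ultrafilter ι)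
    {x : ι → H} {R : ℝ} (hR : ∀ i, ‖x i‖ ≤ R) :
    ∃ a, ∀ v, Tendsto (fun i => inner ℝ (x i) v) U (𝓝 (inner ℝ a v)) := by
  set f : ι → WeakDual ℝ H := fun i =>
    StrongDual.toWeakDual (InnerProductSpace.toDual ℝ H (x i))
  have hK := WeakDual.isCompact_closedBall (𝕜 := ℝ) (0 : StrongDual ℝ H) R
  obtain ⟨g, -, hg⟩ := hK.ultrafilter_le_nhds (U.map f) (by
    refine le_principal_iff.2 (mem_map.2 (univ_mem' fun i => ?_))
    show InnerProductSpace.toDual ℝ H (x i) ∈ Metric.closedBall 0 R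
    rw [mem_closedBall_zero_iff, LinearIsometryEquiv.norm_map]
    exact hR i)
  refine ⟨(InnerProductSpace.toDual ℝ H).symm (WeakDual.toStrongDual g), fun v => ?_⟩
  have h1 : Tendsto (fun i => f i v) U (𝓝 (g v)) :=
    ((WeakDual.eval_continuous v).tendsto g).comp hg
  rw [InnerProductSpace.toDual_symm_apply]
  exact h1

/-- **Opial's lemma.** A sequence whose distances to the points of `Z` converge and whose weak
cluster points lie in `Z` converges weakly to a point of `Z`. -/
theorem exists_forall_tendsto_inner_of_tendsto_norm_sub [CompleteSpace H] {x : ℕ → H} {Z : Set H}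
    (hZ : Z.Nonempty) (hdist : ∀ z ∈ Z, ∃ l, Tendsto (fun n => ‖x n - z‖) atTop (𝓝 l))
    (hcl : ∀ U : Ultrafilter ℕ, ↑U ≤ (atTop : Filter ℕ) → ∀ a,
      (∀ v, Tendsto (fun n => inner ℝ (x n) v) U (𝓝 (inner ℝ a v))) → a ∈ Z) :
    ∃ a ∈ Z, ∀ v, Tendsto (fun n => inner ℝ (x n) v) atTop (𝓝 (inner ℝ a v)) := by
  obtain ⟨z, hz⟩ := hZ
  obtain ⟨R, hR⟩ : ∃ R, ∀ n, ‖x n‖ ≤ R := by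
    obtain ⟨l, hl⟩ := hdist z hz
    obtain ⟨R, hR⟩ := hl.bddAbove_range
    refine ⟨R + ‖z‖, fun n => ?_⟩
    have h1 : ‖x n - z‖ ≤ R := hR ⟨n, rfl⟩
    have h2 := norm_add_le (x n - z) z
    rw [sub_add_cancel] at h2
    linarith
  have hlim := fun U : Ultrafilter ℕ => exists_forall_tendsto_inner_of_norm_le U hR
  obtain ⟨U₀, hU₀⟩ := Ultrafilter.exists_le (atTop : Filter ℕ)
  obtain ⟨a, ha⟩ := hlim U₀
  have haZ := hcl U₀ hU₀ a ha
  refine ⟨a, haZ, fun v => tendsto_iff_ultrafilter _ _ _ |>.2 fun U hU => ?_⟩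
  obtain ⟨b, hb⟩ := hlim U
  have hbZ := hcl U hU b hb
  suffices hab : a = b by rw [hab]; exact hb v
  -- `⟪x n, a - b⟫` converges along the whole sequence, hence has the same limit along `U₀` and `U`.
  obtain ⟨l, hl⟩ := hdist a haZ
  obtain ⟨l', hl'⟩ := hdist b hbZ
  have h1 : Tendsto (fun n => inner ℝ (x n) (a - b)) atTop
      (𝓝 ((‖a‖ ^ 2 - ‖b‖ ^ 2 - l ^ 2 + l' ^ 2) / 2)) := by
    refine ((((tendsto_const_nhds (x := ‖a‖ ^ 2 - ‖b‖ ^ 2)).sub (hl.pow 2)).add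
      (hl'.pow 2)).div_const 2).congr fun n => ?_
    rw [norm_sub_sq_real, norm_sub_sq_real, inner_sub_right]
    ring
  have h2 := tendsto_nhds_unique (h1.mono_left hU₀) (ha (a - b))
  have h3 := tendsto_nhds_unique (h1.mono_left hU) (hb (a - b))
  have h4 : inner ℝ (a - b) (a - b) = 0 := by
    rw [inner_sub_left, ← h2, ← h3, sub_self]
  exact sub_eq_zero.1 (inner_self_eq_zero.1 h4)

/-- If the distances of a sequence to the points of a dense subset of `Z` converge, then so do its
distances to all points of `Z`. -/
theorem exists_tendsto_norm_sub_of_subset_closure {E : Type*} [NormedAddCommGroup E]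
    {x : ℕ → E} {Z Q : Set E} (hQ : Z ⊆ closure Q)
    (h : ∀ q ∈ Q, ∃ l, Tendsto (fun n => ‖x n - q‖) atTop (𝓝 l)) {z : E} (hz : z ∈ Z) :
    ∃ l, Tendsto (fun n => ‖x n - z‖) atTop (𝓝 l) := by
  refine cauchySeq_tendsto_of_complete (Metric.cauchySeq_iff'.2 fun ε hε => ?_)
  obtain ⟨q, hq, hzq⟩ := Metric.mem_closure_iff.1 (hQ hz) (ε / 3) (by positivity)
  obtain ⟨l, hl⟩ := h q hq
  obtain ⟨N, hN⟩ := Metric.cauchySeq_iff'.1 hl.cauchySeq (ε / 3) (by positivity)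
  refine ⟨N, fun n hn => ?_⟩
  have h1 := hN n hn
  rw [Real.dist_eq] at h1 ⊢
  have h2 : ∀ k, |‖x k - z‖ - ‖x k - q‖| ≤ dist z q := fun k => by
    refine (abs_norm_sub_norm_le _ _).trans (le_of_eq ?_)
    rw [sub_sub_sub_cancel_left, dist_comm, dist_eq_norm]
  have h3 := abs_le.1 (h2 n)
  have h4 := abs_le.1 (h2 N)
  have h5 := abs_lt.1 h1
  rw [abs_lt]
  constructor <;> linarith [h3.1, h3.2, h4.1, h4.2, h5.1, h5.2]

/-- In a separable Hilbert space, weakly measurable functions are Borel measurable. -/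
theorem measurable_of_forall_measurable_inner [TopologicalSpace.SeparableSpace H]
    [MeasurableSpace H] [BorelSpace H] {Ω : Type*} [MeasurableSpace Ω] {f : Ω → H}
    (hf : ∀ v, Measurable fun ω => inner ℝ (f ω) v) : Measurable f := by
  set d := TopologicalSpace.denseSeq H
  have hd : DenseRange d := TopologicalSpace.denseRange_denseSeq H
  have hball : ∀ c r, 0 ≤ r → MeasurableSet {ω | ‖f ω - c‖ ≤ r} := by
    intro c r hr
    have h1 : {ω | ‖f ω - c‖ ≤ r} = ⋂ n, {ω | inner ℝ (f ω - c) (d n) ≤ r * ‖d n‖} := by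
      ext ω
      simp only [Set.mem_iInter]
      constructor
      · intro h n
        exact (real_inner_le_norm _ _).trans (mul_le_mul_of_nonneg_right h (norm_nonneg _))
      · intro h
        have h2 : ∀ v, inner ℝ (f ω - c) v ≤ r * ‖v‖ := fun v =>
          hd.induction_on (p := fun v => inner ℝ (f ω - c) v ≤ r * ‖v‖) v
            (isClosed_le (continuous_const.inner continuous_id)
              (continuous_const.mul continuous_norm)) h
        have h3 := h2 (f ω - c)
        rw [real_inner_self_eq_norm_sq, sq] at h3
        show ‖f ω - c‖ ≤ r
        rcases (norm_nonneg (f ω - c)).eq_or_lt' with h0 | h0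
        · rwa [h0]
        · exact le_of_mul_le_mul_right h3 h0
    rw [h1]
    refine MeasurableSet.iInter fun n => ?_
    simp only [inner_sub_left]
    exact measurableSet_le ((hf _).sub_const _) measurable_const
  refine measurable_of_isOpen fun O hO => ?_
  have h1 : f ⁻¹' O = ⋃ (n : ℕ) (k : ℕ) (_ : Metric.closedBall (d n) (1 / ((k : ℝ) + 1)) ⊆ O),
      {ω | ‖f ω - d n‖ ≤ 1 / ((k : ℝ) + 1)} := by
    ext ω
    simp only [Set.mem_iUnion]
    constructor
    · intro h
      obtain ⟨ε, hε, hball⟩ := Metric.isOpen_iff.1 hO (f ω) h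
      obtain ⟨k, hk⟩ := exists_nat_one_div_lt (half_pos hε)
      obtain ⟨n, hn⟩ := hd.exists_dist_lt (f ω) (Nat.one_div_pos_of_nat (α := ℝ) (n := k))
      refine ⟨n, k, fun y hy => hball ?_, ?_⟩
      · have h2 := dist_triangle_right y (f ω) (d n)
        rw [Metric.mem_closedBall] at hy
        rw [Metric.mem_ball]
        linarith
      · show ‖f ω - d n‖ ≤ _
        rw [← dist_eq_norm]
        exact hn.le
    · rintro ⟨n, k, hsub, h⟩
      refine hsub ?_
      rw [Metric.mem_closedBall, dist_eq_norm]
      exact h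
  rw [h1]
  exact MeasurableSet.iUnion fun n => .iUnion fun k => .iUnion fun _ =>
    hball _ _ (by positivity)

/-- An almost sure weak limit of random variables has a measurable version with values in any set
that almost surely contains it. -/
theorem exists_measurable_ae_tendsto_inner [TopologicalSpace.SeparableSpace H]
    [MeasurableSpace H] [BorelSpace H] {Ω : Type*} [MeasurableSpace Ω] {P : Measure Ω}
    {x : ℕ → Ω → H} {Z : Set H} (hZ : Z.Nonempty) (hx : ∀ n, Measurable (x n))
    (h : ∀ᵐ ω ∂P, ∃ a ∈ Z, ∀ v, Tendsto (fun n => inner ℝ (x n ω) v) atTop (𝓝 (inner ℝ a v))) :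
    ∃ xbar : Ω → H, Measurable xbar ∧ (∀ ω, xbar ω ∈ Z) ∧
      ∀ᵐ ω ∂P, ∀ v, Tendsto (fun n => inner ℝ (x n ω) v) atTop (𝓝 (inner ℝ (xbar ω) v)) := by
  classical
  obtain ⟨z, hz⟩ := hZ
  obtain ⟨G, hG, hGm, hGsub⟩ := h.exists_measurable_mem
  choose! a haZ ha using hGsub
  refine ⟨G.piecewise a fun _ => z, ?_, fun ω => ?_, ?_⟩
  · refine measurable_of_forall_measurable_inner fun v => ?_
    refine measurable_of_tendsto_metrizable
      (f := fun n => G.piecewise (fun ω => inner ℝ (x n ω) v) fun _ => inner ℝ z v)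
      (fun n => Measurable.piecewise hGm ((hx n).inner measurable_const) measurable_const) ?_
    refine tendsto_pi_nhds.2 fun ω => ?_
    by_cases hω : ω ∈ G
    · simpa [hω] using ha ω hω v
    · simp [hω]
  · by_cases hω : ω ∈ G
    · simpa [hω] using haZ ω hω
    · simpa [hω] using hz
  · filter_upwards [hG] with ω hω v
    simpa [hω] using ha ω hω v

end WeakConvergence

/-! ### Energy estimates for one step of the iteration -/

section Energy

variable {H : Type*} [NormedAddCommGroup H] [InnerProductSpace ℝ H]

/-- The Lyapunov function of the reflected forward-backward iteration. With `p = x n - z`,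
`d = x n - x (n - 1)`, `a = x n - y (n - 1)`, `g = B (y (n - 1)) - B z`, it is used with
`α = 1 / γ n` and `β = 1 / γ (n - 1)`. -/
noncomputable def reflectedEnergy (μ α β : ℝ) (p d a g : H) : ℝ :=
  α * ‖p‖ ^ 2 + 2 * inner ℝ d g + (β + μ * (1 + √2)) * ‖d‖ ^ 2 + μ * ‖a‖ ^ 2

theorem two_mul_inner_le {μ : ℝ} (hμ : 0 ≤ μ) {d g p a : H} (hg : ‖g‖ ≤ μ * ‖p - a‖) :
    |2 * inner ℝ d g| ≤ 2 * μ * ‖d‖ * (‖p‖ + ‖a‖) := by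
  rw [abs_mul, abs_of_pos (zero_lt_two' ℝ)]
  have h1 := abs_real_inner_le_norm d g
  have h2 : ‖d‖ * ‖g‖ ≤ ‖d‖ * (μ * (‖p‖ + ‖a‖)) :=
    mul_le_mul_of_nonneg_left
      (hg.trans (mul_le_mul_of_nonneg_left (norm_sub_le p a) hμ)) (norm_nonneg d)
  linarith

theorem sub_mul_norm_sq_le_reflectedEnergy {μ α β : ℝ} (hμ : 0 ≤ μ) (hβ : 0 ≤ β) {p d a g : H}
    (hg : ‖g‖ ≤ μ * ‖p - a‖) : (α - μ) * ‖p‖ ^ 2 ≤ reflectedEnergy μ α β p d a g := by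
  have h1 := (abs_le.1 (two_mul_inner_le hμ (d := d) hg)).1
  have h2 : 1 ≤ √2 := Real.one_le_sqrt.2 (by norm_num)
  have h3 := mul_nonneg hμ (sq_nonneg (‖d‖ - ‖p‖))
  have h4 := mul_nonneg hμ (sq_nonneg (‖d‖ - ‖a‖))
  have h5 := mul_nonneg (mul_nonneg hμ (sub_nonneg.2 h2)) (sq_nonneg ‖d‖)
  have h6 := mul_nonneg hβ (sq_nonneg ‖d‖)
  unfold reflectedEnergy
  nlinarith

/-- One step of the iteration decreases the energy up to noise. Besides monotonicity of `A` between
the new iterate and the zero `z` (`h1`), the estimate uses it between two consecutive iterates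
(`h2`), and monotonicity of `B` between the reflected point and `z` (`h3`). -/
theorem reflectedEnergy_step_le {μ α α' β : ℝ} (hμ : 0 ≤ μ) {p d₁ d₂ a₁ g₁ g₂ e₁ e₂ : H}
    (h1 : 0 ≤ inner ℝ (p + d₂) (-(α • d₂) - g₂ - e₂))
    (h2 : 0 ≤ inner ℝ d₂ ((-(α • d₂) - g₂ - e₂) - (-(β • d₁) - g₁ - e₁)))
    (h3 : 0 ≤ inner ℝ (p + d₁) g₂) (h4 : ‖g₂ - g₁‖ ≤ μ * ‖d₁ + a₁‖)
    (hβ : μ * (1 + √2) ≤ β) (hα : α' ≤ α) :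
    reflectedEnergy μ α' α (p + d₂) d₂ (d₂ - d₁) g₂ ≤ reflectedEnergy μ α β p d₁ a₁ g₁
      - (2 * α - β - μ * (1 + √2)) * ‖d₂‖ ^ 2 - 2 * inner ℝ d₂ ((2 : ℝ) • e₂ - e₁)
      - 2 * inner ℝ p e₂ := by
  set a₂ := d₂ - d₁ with ha₂
  have ha₂sq : ‖a₂‖ ^ 2 = ‖d₂‖ ^ 2 - 2 * inner ℝ d₂ d₁ + ‖d₁‖ ^ 2 := norm_sub_sq_real _ _
  have hsq : √2 ^ 2 = 2 := Real.sq_sqrt (by norm_num)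
  have hLip : -(μ * (√2 * ‖a₂‖ ^ 2 + (√2 + 1) * ‖d₁‖ ^ 2 + ‖a₁‖ ^ 2))
      ≤ 2 * inner ℝ a₂ (g₂ - g₁) := by
    have k1 := (abs_le.1 (abs_real_inner_le_norm a₂ (g₂ - g₁))).1
    have k2 : ‖a₂‖ * ‖g₂ - g₁‖ ≤ ‖a₂‖ * (μ * (‖d₁‖ + ‖a₁‖)) :=
      mul_le_mul_of_nonneg_left
        (h4.trans (mul_le_mul_of_nonneg_left (norm_add_le _ _) hμ)) (norm_nonneg _)
    -- Young's inequality with the weights `√2 - 1` and `√2 + 1`, whose product is `1`.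
    have k3 : 2 * (‖a₂‖ * ‖d₁‖) ≤ (√2 - 1) * ‖a₂‖ ^ 2 + (√2 + 1) * ‖d₁‖ ^ 2 := by
      have k4 : 0 ≤ (√2 - 1) * (‖a₂‖ - (√2 + 1) * ‖d₁‖) ^ 2 :=
        mul_nonneg (sub_nonneg.2 (Real.one_le_sqrt.2 (by norm_num))) (sq_nonneg _)
      have k5 : (√2 - 1) * (‖a₂‖ - (√2 + 1) * ‖d₁‖) ^ 2
          = (√2 - 1) * ‖a₂‖ ^ 2 - 2 * (‖a₂‖ * ‖d₁‖) + (√2 + 1) * ‖d₁‖ ^ 2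
            + (√2 ^ 2 - 2) * ((√2 + 1) * ‖d₁‖ ^ 2 - 2 * (‖a₂‖ * ‖d₁‖)) := by ring
      rw [hsq, sub_self, zero_mul, add_zero] at k5
      linarith
    have k6 := mul_le_mul_of_nonneg_left k3 hμ
    have k7 := mul_nonneg hμ (sq_nonneg (‖a₂‖ - ‖a₁‖))
    nlinarith
  have hβ' := mul_le_mul_of_nonneg_right hβ (sq_nonneg ‖a₂‖)
  have hα' := mul_le_mul_of_nonneg_right hα (sq_nonneg ‖p + d₂‖)
  have hp := norm_add_sq_real p d₂
  unfold reflectedEnergy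
  rw [ha₂] at hLip
  simp only [inner_add_left, inner_sub_left, inner_sub_right, inner_neg_right,
    real_inner_smul_right, real_inner_self_eq_norm_sq] at h1 h2 h3 hLip ⊢
  rw [← ha₂] at hLip
  rw [hp] at hα' ⊢
  rw [ha₂sq] at hLip hβ' ⊢
  nlinarith

/-- Along a sequence with vanishing increments, convergence of the energies amounts to convergence
of the distances to the zero. -/
theorem exists_tendsto_norm_of_tendsto_reflectedEnergy {μ l α₀ : ℝ} (hμ : 0 < μ) {α β : ℕ → ℝ}
    {p d a g : ℕ → H} (hg : ∀ n, ‖g n‖ ≤ μ * ‖p n - a n‖) (hα : ∀ n, μ * (1 + √2) ≤ α n)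
    (hβ : ∀ n, 0 ≤ β n) (hαlim : Tendsto α atTop (𝓝 α₀)) (hβlim : Tendsto β atTop (𝓝 α₀))
    (hd : Tendsto d atTop (𝓝 0)) (ha : Tendsto a atTop (𝓝 0))
    (hE : Tendsto (fun n => reflectedEnergy μ (α n) (β n) (p n) (d n) (a n) (g n)) atTop (𝓝 l)) :
    ∃ l', Tendsto (fun n => ‖p n‖) atTop (𝓝 l') := by
  have hs : 0 < √2 := by positivity
  have hα₀ : 0 < α₀ := lt_of_lt_of_le (by positivity) (ge_of_tendsto' hαlim hα)
  obtain ⟨R, hR⟩ := hE.bddAbove_range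
  have hpb : ∀ n, ‖p n‖ ≤ √(R / (μ * √2)) := by
    intro n
    refine Real.le_sqrt_of_sq_le ((le_div_iff₀ (by positivity)).2 ?_)
    have h1 := sub_mul_norm_sq_le_reflectedEnergy hμ.le (hβ n) (α := α n) (d := d n) (hg n)
    have h2 : reflectedEnergy μ (α n) (β n) (p n) (d n) (a n) (g n) ≤ R := hR ⟨n, rfl⟩
    have h3 := mul_le_mul_of_nonneg_right (hα n) (sq_nonneg ‖p n‖)
    linarith
  have hdn : Tendsto (fun n => ‖d n‖) atTop (𝓝 0) := by simpa using hd.norm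
  have han : Tendsto (fun n => ‖a n‖) atTop (𝓝 0) := by simpa using ha.norm
  have hcross : Tendsto (fun n => 2 * inner ℝ (d n) (g n)) atTop (𝓝 0) := by
    refine squeeze_zero_norm (a := fun n => 2 * μ * ‖d n‖ * (√(R / (μ * √2)) + ‖a n‖))
      (fun n => ?_) ?_
    · rw [Real.norm_eq_abs]
      refine (two_mul_inner_le hμ.le (hg n)).trans ?_
      have := hpb n
      gcongr
    · simpa using (hdn.const_mul (2 * μ)).mul (han.const_add (√(R / (μ * √2))))
  have h1 : Tendsto (fun n => α n * ‖p n‖ ^ 2) atTop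
      (𝓝 (l - 0 - (α₀ + μ * (1 + √2)) * 0 ^ 2 - μ * 0 ^ 2)) := by
    refine (((hE.sub hcross).sub ((hβlim.add_const _).mul (hdn.pow 2))).sub
      ((han.pow 2).const_mul μ)).congr fun n => ?_
    unfold reflectedEnergy
    ring
  have h2 := (h1.div hαlim hα₀.ne').sqrt
  refine ⟨_, h2.congr fun n => ?_⟩
  have hαn : α n ≠ 0 := (lt_of_lt_of_le (by positivity) (hα n)).ne'
  rw [Pi.div_apply, mul_div_cancel_left₀ _ hαn, Real.sqrt_sq (norm_nonneg _)]

/-- One step of the iteration with bounded values of `B`: the terms that measure the monotonicity of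
`A` and of `B` are kept, all others are controlled by `γ²`. -/
theorem norm_add_sq_add_le {γ M : ℝ} (hγ : 0 < γ) {p d₁ d₂ g e : H} (hg : ‖g‖ ≤ M) :
    (‖p + d₂‖ ^ 2 + ‖d₂‖ ^ 2 / 4) + (‖d₂‖ ^ 2 / 4
      + 2 * γ * (inner ℝ (p + d₂) (-(γ⁻¹ • d₂) - g - e) + inner ℝ (p + d₁) g))
      ≤ (‖p‖ ^ 2 + ‖d₁‖ ^ 2 / 4) + 8 * M ^ 2 * γ ^ 2 + 4 * γ ^ 2 * ‖e‖ ^ 2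
        - 2 * γ * inner ℝ p e := by
  have young : ∀ (v w : H), |2 * γ * inner ℝ v w| ≤ ‖v‖ ^ 2 / 4 + 4 * γ ^ 2 * ‖w‖ ^ 2 := by
    intro v w
    rw [abs_mul, abs_of_pos (by positivity : 0 < 2 * γ)]
    have h1 := mul_le_mul_of_nonneg_left (abs_real_inner_le_norm v w) hγ.le
    nlinarith [sq_nonneg (‖v‖ / 2 - 2 * γ * ‖w‖)]
  have hgM : 4 * γ ^ 2 * ‖g‖ ^ 2 ≤ 4 * γ ^ 2 * M ^ 2 := by gcongr
  have h1 := (abs_le.1 (young d₂ g)).1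
  have h2 := (abs_le.1 (young d₁ g)).2
  have h3 := (abs_le.1 (young d₂ e)).1
  have hp := norm_add_sq_real p d₂
  simp only [inner_add_left, inner_sub_right, inner_neg_right, real_inner_smul_right,
    real_inner_self_eq_norm_sq]
  rw [hp]
  have h4 : ∀ t : ℝ, γ * (γ⁻¹ * t) = t := fun t => mul_inv_cancel_left₀ hγ.ne' t
  have h5 := h4 (inner ℝ p d₂)
  have h6 := h4 (‖d₂‖ ^ 2)
  nlinarith

end Energy

/-! ### Uniform monotonicity -/

namespace SetValued

variable {H : Type*} [NormedAddCommGroup H] [InnerProductSpace ℝ H]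

/-- A real-valued form of uniform monotonicity at a point: pairs at distance at least `t` have inner
product bounded below by a positive constant. The truncation at `1` disposes of infinite values of
the modulus. -/
theorem IsUniformlyMonotone.exists_pos_le_inner {C : H → Set H} (hC : IsUniformlyMonotone C)
    {z u : H} (hu : u ∈ C z) {t : ℝ} (ht : 0 < t) :
    ∃ η > 0, ∀ y, ∀ v ∈ C y, t ≤ ‖y - z‖ → η ≤ inner ℝ (y - z) (v - u) := by
  obtain ⟨φ, hmono, hzero, hφ⟩ := hC z ⟨u, hu⟩
  have htop : min (φ t.toNNReal) 1 ≠ ∞ := ne_top_of_le_ne_top ENNReal.one_ne_top (min_le_right _ _)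
  have hpos : 0 < min (φ t.toNNReal) 1 := by
    refine lt_min (pos_iff_ne_zero.2 fun h => ?_) zero_lt_one
    rw [hzero] at h
    exact ht.not_ge (Real.toNNReal_eq_zero.1 h)
  refine ⟨(min (φ t.toNNReal) 1).toReal, ENNReal.toReal_pos hpos.ne' htop, fun y v hv hty => ?_⟩
  have h1 := hφ u hu (y, v) hv
  have h2 : min (φ t.toNNReal) 1 ≤ φ ‖y - z‖₊ :=
    (min_le_left _ _).trans (hmono (Real.toNNReal_le_iff_le_coe.2 hty))
  have h3 := (EReal.coe_ennreal_le_coe_ennreal_iff.2 h2).trans h1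
  rw [← ENNReal.ofReal_toReal htop, EReal.coe_ennreal_ofReal,
    max_eq_left ENNReal.toReal_nonneg, EReal.coe_le_coe_iff] at h3
  rwa [← neg_sub z y, ← neg_sub u v, inner_neg_neg]

theorem IsMonotone.eq_of_mem_zer_of_isUniformlyMonotone {A : H → Set H} {B : H → H}
    (hA : IsMonotone A) (hB : IsMonotone (ofFun B))
    (hAB : IsUniformlyMonotone A ∨ IsUniformlyMonotone (ofFun B)) {z z' : H}
    (hz : z ∈ zer (sum A (ofFun B))) (hz' : z' ∈ zer (sum A (ofFun B))) : z' = z := by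
  rw [mem_zer_sum_ofFun_iff] at hz hz'
  by_contra hne
  have ht : 0 < ‖z' - z‖ := norm_pos_iff.2 (sub_ne_zero.2 hne)
  have h1 := hA.inner_nonneg hz' hz
  have h2 := hB.inner_ofFun_nonneg z' z
  have h3 : inner ℝ (z' - z) (-B z' - -B z) = -inner ℝ (z' - z) (B z' - B z) := by
    rw [← inner_neg_right]
    congr 1
    abel
  rcases hAB with h | h
  · obtain ⟨η, hη, hle⟩ := h.exists_pos_le_inner hz ht
    have := hle z' _ hz' le_rfl
    linarith
  · obtain ⟨η, hη, hle⟩ := h.exists_pos_le_inner (z := z) (u := B z) rfl ht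
    have := hle z' (B z') rfl le_rfl
    linarith

end SetValued

/-! ### Convergence of sample paths -/

section Paths

variable {H : Type*} [NormedAddCommGroup H] [InnerProductSpace ℝ H]

theorem tendsto_zero_of_tsum_ofReal_mul_norm_sq_ne_top {E : Type*}
    [NormedAddCommGroup E] {d : ℕ → E} {c : ℝ}
    (hc : 0 < c) (h : ∑' n, ENNReal.ofReal (c * ‖d n‖ ^ 2) ≠ ∞) :
    Tendsto d atTop (𝓝 0) := by
  have h1 := (ENNReal.summable_toReal h).tendsto_atTop_zero
  simp only [ENNReal.toReal_ofReal (mul_nonneg hc.le (sq_nonneg _))] at h1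
  have h2 := (h1.const_mul c⁻¹).sqrt
  simp only [inv_mul_cancel_left₀ hc.ne', Real.sqrt_sq (norm_nonneg _), mul_zero,
    Real.sqrt_zero] at h2
  exact tendsto_zero_iff_norm_tendsto_zero.2 h2

/-- If `p` stayed away from `0`, then so would `s`, and `∑ γ s` would dominate a multiple of the
divergent series `∑ γ`. -/
theorem tendsto_zero_of_summable_mul {E : Type*} [NormedAddCommGroup E] {p d : ℕ → E}
    {γ s : ℕ → ℝ} {l : ℝ}
    (hγ : ∀ n, 0 ≤ γ n) (hγsum : ¬ Summable γ) (hs : ∀ n, 0 ≤ s n)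
    (hV : Tendsto (fun n => ‖p n‖ ^ 2 + ‖d n‖ ^ 2 / 4) atTop (𝓝 l))
    (hθ : Summable fun n => ‖d (n + 1)‖ ^ 2 / 4 + 2 * γ n * s n)
    (hmod : ∀ t > 0, ∃ η > 0, ∀ n, t ≤ ‖p (n + 1)‖ → t ≤ ‖p n + d n‖ → η ≤ s n) :
    Tendsto p atTop (𝓝 0) := by
  have hd2 : Tendsto (fun n => ‖d n‖ ^ 2) atTop (𝓝 0) := by
    rw [← tendsto_add_atTop_iff_nat 1]
    refine squeeze_zero (fun n => sq_nonneg _) (fun n => ?_)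
      (by simpa using hθ.tendsto_atTop_zero.const_mul 4)
    have := mul_nonneg (mul_nonneg zero_le_two (hγ n)) (hs n)
    linarith
  have hd : Tendsto (fun n => ‖d n‖) atTop (𝓝 0) := by
    simpa [Real.sqrt_sq (norm_nonneg _)] using hd2.sqrt
  have hp : Tendsto (fun n => ‖p n‖) atTop (𝓝 √l) := by
    have h1 := (hV.sub (hd2.div_const 4)).sqrt
    simpa [Real.sqrt_sq (norm_nonneg _)] using h1
  suffices h0 : √l = 0 by
    rw [h0] at hp
    exact tendsto_zero_iff_norm_tendsto_zero.2 hp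
  by_contra hne
  have hL : 0 < √l := lt_of_le_of_ne (Real.sqrt_nonneg l) (Ne.symm hne)
  obtain ⟨η, hη, hle⟩ := hmod (√l / 2) (half_pos hL)
  have h1 : ∀ᶠ n in atTop, √l / 2 ≤ ‖p (n + 1)‖ :=
    ((tendsto_add_atTop_iff_nat 1).2 hp).eventually_const_le (half_lt_self hL)
  have h2 : ∀ᶠ n in atTop, √l / 2 ≤ ‖p n‖ - ‖d n‖ :=
    (hp.sub hd).eventually_const_le (by rw [sub_zero]; exact half_lt_self hL)
  refine hγsum ?_
  refine Summable.of_norm_bounded_eventually_nat (hθ.mul_left (1 / (2 * η))) ?_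
  filter_upwards [h1, h2] with n h3 h4
  have h5 := hle n h3 (h4.trans (by
    have := norm_sub_norm_le (p n) (-d n)
    rwa [norm_neg, sub_neg_eq_add] at this))
  rw [Real.norm_of_nonneg (hγ n), one_div, inv_mul_eq_div, le_div_iff₀ (by positivity)]
  have h6 := mul_le_mul_of_nonneg_left h5 (hγ n)
  have h7 := sq_nonneg ‖d (n + 1)‖
  linarith

open SetValued in
/-- A path whose distances to all zeros converge, whose increments and noise vanish, converges
weakly to a zero. -/
theorem exists_mem_zer_forall_tendsto_inner [CompleteSpace H] {A : H → Set H}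
    (hA : IsMaximallyMonotone A) {B : H → H} {K : ℝ≥0} (hB : LipschitzWith K B)
    (hBm : IsMonotone (ofFun B)) (hZ : (zer (sum A (ofFun B))).Nonempty) {x y r : ℕ → H}
    {γ : ℕ → ℝ} {G : ℝ} (hγ : ∀ n, |(γ n)⁻¹| ≤ G)
    (hu : ∀ n, (γ n)⁻¹ • (x n - x (n + 1)) - r n ∈ A (x (n + 1)))
    (hdist : ∀ z ∈ zer (sum A (ofFun B)), ∃ l, Tendsto (fun n => ‖x n - z‖) atTop (𝓝 l))
    (hd : Tendsto (fun n => x (n + 1) - x n) atTop (𝓝 0))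
    (hy : Tendsto (fun n => x (n + 1) - y n) atTop (𝓝 0))
    (hr : Tendsto (fun n => r n - B (y n)) atTop (𝓝 0)) :
    ∃ a ∈ zer (sum A (ofFun B)), ∀ v, Tendsto (fun n => inner ℝ (x n) v) atTop
      (𝓝 (inner ℝ a v)) := by
  refine exists_forall_tendsto_inner_of_tendsto_norm_sub hZ hdist fun U hU a ha => ?_
  obtain ⟨z, hz⟩ := hZ
  obtain ⟨l, hl⟩ := hdist z hz
  obtain ⟨R, hR⟩ := hl.bddAbove_range
  refine hA.mem_zer_of_tendsto hB hBm (l := (U : Filter ℕ)) hu (R := R + ‖z‖) (fun n => ?_)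
    (fun v => ?_) ?_
  · have h1 : ‖x (n + 1) - z‖ ≤ R := hR ⟨n + 1, rfl⟩
    have h2 := norm_add_le (x (n + 1) - z) z
    rw [sub_add_cancel] at h2
    linarith
  · have h1 : Tendsto (fun n => inner ℝ (x (n + 1) - x n) v) U (𝓝 0) := by
      simpa using (hd.mono_left hU).inner (tendsto_const_nhds (x := v))
    simpa [inner_sub_left] using h1.add (ha v)
  · have h1 : Tendsto (fun n => (γ n)⁻¹ • (x n - x (n + 1))) atTop (𝓝 0) := by
      refine squeeze_zero_norm (a := fun n => G * ‖x (n + 1) - x n‖) (fun n => ?_)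
        (by simpa using hd.norm.const_mul G)
      rw [norm_smul, Real.norm_eq_abs, norm_sub_rev]
      exact mul_le_mul_of_nonneg_right (hγ n) (norm_nonneg _)
    have h2 : Tendsto (fun n => B (x (n + 1)) - B (y n)) atTop (𝓝 0) :=
      squeeze_zero_norm (a := fun n => K * ‖x (n + 1) - y n‖) (fun n => hB.norm_sub_le _ _)
        (by simpa using hy.norm.const_mul (K : ℝ))
    have h3 := ((h1.sub hr).add h2).mono_left hU
    simp only [sub_zero, add_zero] at h3
    refine h3.congr fun n => ?_
    abel

end Paths

/-! ### The stochastic iteration -/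

section Iteration

open SetValued

variable {Ω H : Type*} [MeasurableSpace H]

theorem measurable_pastSigma (x : ℕ → Ω → H) {k n : ℕ} (hk : k ≤ n) :
    Measurable[pastSigma x n] (x k) :=
  (comap_measurable (x k)).mono (le_iSup₂ (f := fun k (_ : k ≤ n) =>
    MeasurableSpace.comap (x k) inferInstance) k hk) le_rfl

/-- The filtration `F (n + 1)`. Starting it at `F 1` discards `y 0`, the only reflected point that
involves `x₋₁`, which need not be measurable with respect to any `F n`. -/
def shiftedPastFiltration [m0 : MeasurableSpace Ω] (x : ℕ → Ω → H) (hx : ∀ n, Measurable (x n)) :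
    Filtration ℕ m0 where
  seq n := pastSigma x (n + 1)
  mono' i j hij := iSup_mono fun k => iSup_mono' fun hk => ⟨by lia, le_rfl⟩
  le' n := iSup₂_le fun k _ => (hx k).comap_le

variable [NormedAddCommGroup H]

theorem stronglyMeasurable_pastSigma [BorelSpace H] [TopologicalSpace.SeparableSpace H]
    (x : ℕ → Ω → H) {k n : ℕ} (hk : k ≤ n) :
    StronglyMeasurable[pastSigma x n] (x k) :=
  have := UniformSpace.secondCountable_of_separable H
  (measurable_pastSigma x hk).stronglyMeasurable

variable [InnerProductSpace ℝ H]

/-- The error `r n - B (y n)` of the stochastic estimates, from `n = 1` on. -/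
def estimatorNoise (B : H → H) (x r : ℕ → Ω → H) (n : ℕ) : Ω → H :=
  fun ω => r (n + 1) ω - B ((2 : ℝ) • x (n + 1) ω - x n ω)

theorem stronglyMeasurable_reflected [BorelSpace H] [TopologicalSpace.SeparableSpace H]
    {B : H → H} (hB : Continuous B) (x : ℕ → Ω → H) {k n : ℕ} (hk : k + 1 ≤ n) :
    StronglyMeasurable[pastSigma x n] fun ω => B ((2 : ℝ) • x (k + 1) ω - x k ω) :=
  hB.comp_stronglyMeasurable (((stronglyMeasurable_pastSigma x hk).const_smul (2 : ℝ)).sub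
    (stronglyMeasurable_pastSigma x (by lia)))

variable [MeasurableSpace Ω] {P : Measure Ω} {B : H → H} {γ : ℕ → ℝ} {xm : Ω → H}
  {x r : ℕ → Ω → H}

theorem tsum_mul_condLExp_estimatorNoise_ne_top (hx : ∀ n, Measurable (x n)) {β : ℕ → ℝ≥0∞} {ω : Ω}
    (h : ∑' n, β n * estimatorVariance P B xm x r n ω < ∞) :
    ∑' n, β (n + 1) * condLExp (shiftedPastFiltration x hx n) P
      (fun ω => ‖estimatorNoise B x r n ω‖ₑ ^ 2) ω ≠ ∞ :=
  ne_top_of_le_ne_top h.ne (ENNReal.tsum_comp_le_tsum_of_injective (add_left_injective 1)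
    fun n => β n * estimatorVariance P B xm x r n ω)

variable [CompleteSpace H] {A : H → Set H}

theorem IsStochasticReflectedFB.ae_mem (halg : IsStochasticReflectedFB P A B γ xm x r) :
    ∀ᵐ ω ∂P, ∀ n, (γ n)⁻¹ • (x n ω - x (n + 1) ω) - r n ω ∈ A (x (n + 1) ω) := by
  refine ae_all_iff.2 fun n => ?_
  filter_upwards [halg.iterate n] with ω hω
  obtain ⟨u, hu, h⟩ := mem_resolvent_scale_iff.1 hω
  have h1 : x n ω - x (n + 1) ω = γ n • (u + r n ω) := by
    rw [smul_add, sub_eq_iff_eq_add', ← add_assoc, h, sub_add_cancel]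
  rwa [h1, inv_smul_smul₀ (halg.step_pos n).ne', add_sub_cancel_right]

theorem IsStochasticReflectedFB.integrable_estimatorNoise [IsProbabilityMeasure P]
    (halg : IsStochasticReflectedFB P A B γ xm x r) (n : ℕ) :
    Integrable (estimatorNoise B x r n) P :=
  (halg.integrable (n + 1)).sub (integrable_condExp.congr (halg.unbiased (n + 1)))

theorem IsStochasticReflectedFB.condExp_estimatorNoise [BorelSpace H]
    [TopologicalSpace.SeparableSpace H] [IsProbabilityMeasure P]
    (halg : IsStochasticReflectedFB P A B γ xm x r) (hB : Continuous B) (n : ℕ) :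
    P[estimatorNoise B x r n | shiftedPastFiltration x halg.measurable n] =ᵐ[P] 0 := by
  have hint : Integrable (fun ω => B (reflectedPoint xm x (n + 1) ω)) P :=
    integrable_condExp.congr (halg.unbiased (n + 1))
  have h1 := condExp_sub (halg.integrable (n + 1)) hint
    (shiftedPastFiltration x halg.measurable n)
  have h2 : P[fun ω => B (reflectedPoint xm x (n + 1) ω) |
      shiftedPastFiltration x halg.measurable n] = _ :=
    condExp_of_stronglyMeasurable ((shiftedPastFiltration x halg.measurable).le n)
      (stronglyMeasurable_reflected hB x le_rfl) hint
  filter_upwards [h1, halg.unbiased (n + 1)] with ω h3 h4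
  refine h3.trans ?_
  rw [Pi.sub_apply, h2]
  exact sub_eq_zero.2 h4

end Iteration

/-! ### Almost sure convergence -/

section Convergence

open SetValued

variable {Ω H : Type*} [NormedAddCommGroup H] [InnerProductSpace ℝ H] [CompleteSpace H]
  [TopologicalSpace.SeparableSpace H] [MeasurableSpace H] [BorelSpace H] [MeasurableSpace Ω]
  {P : Measure Ω} [IsProbabilityMeasure P] {A : H → Set H} {B : H → H} {μ : ℝ≥0} {γ : ℕ → ℝ}
  {xm : Ω → H} {x r : ℕ → Ω → H}

/-- Under nondecreasing step sizes, the distances to a fixed zero converge almost surely, and the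
increments and the noise vanish. -/
theorem IsStochasticReflectedFB.ae_tendsto_norm_sub (hA : IsMonotone A) (hμ : 0 < μ)
    (hBlip : LipschitzWith μ B) (hBmono : IsMonotone (ofFun B))
    (halg : IsStochasticReflectedFB P A B γ xm x r)
    (hγlt : ∀ n, γ n < (√2 - 1) / μ) (hγmono : Monotone γ) {δ : ℝ} (hδ : 0 < δ)
    (hγδ : ∀ n, δ ≤ 2 / γ (n + 1) - 1 / γ n - (μ : ℝ) * (1 + √2))
    (hvar : ∀ᵐ ω ∂P, ∑' n, estimatorVariance P B xm x r n ω < ∞) {z : H}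
    (hz : z ∈ zer (sum A (ofFun B))) :
    ∀ᵐ ω ∂P, (∃ l, Tendsto (fun n => ‖x n ω - z‖) atTop (𝓝 l)) ∧
      Tendsto (fun n => x (n + 1) ω - x n ω) atTop (𝓝 0) ∧
      Tendsto (fun n => estimatorNoise B x r n ω) atTop (𝓝 0) := by
  rw [mem_zer_sum_ofFun_iff] at hz
  have hμ' : (0 : ℝ) < μ := hμ
  have hs : 0 < √2 := by positivity
  have hsq : √2 ^ 2 = 2 := Real.sq_sqrt (by norm_num)
  have hpos := halg.step_pos
  have hα : ∀ n, (μ : ℝ) * (1 + √2) ≤ (γ n)⁻¹ := by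
    intro n
    have h1 := hγlt n
    rw [lt_div_iff₀ hμ'] at h1
    rw [le_inv_comm₀ (by positivity) (hpos n), ← one_div, le_div_iff₀ (by positivity)]
    have h2 := mul_le_mul_of_nonneg_right h1.le (by positivity : 0 ≤ 1 + √2)
    nlinarith
  have hαanti : Antitone fun n => (γ n)⁻¹ := fun i j hij =>
    inv_anti₀ (hpos i) (hγmono hij)
  obtain ⟨α₀, hα₀⟩ : ∃ α₀, Tendsto (fun n => (γ n)⁻¹) atTop (𝓝 α₀) :=
    ⟨_, tendsto_atTop_ciInf hαanti ⟨_, by rintro _ ⟨n, rfl⟩; exact hα n⟩⟩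
  -- The index `k` stands for the iterate `n = k + 2`, the first whose energy avoids `x₋₁`.
  set p : ℕ → Ω → H := fun k ω => x (k + 2) ω - z
  set d : ℕ → Ω → H := fun k ω => x (k + 2) ω - x (k + 1) ω
  set a : ℕ → Ω → H := fun k ω => x (k + 2) ω - x (k + 1) ω - (x (k + 1) ω - x k ω)
  set g : ℕ → Ω → H := fun k ω => B ((2 : ℝ) • x (k + 1) ω - x k ω) - B z
  set e := estimatorNoise B x r
  set V : ℕ → Ω → ℝ := fun k ω =>
    reflectedEnergy μ (γ (k + 2))⁻¹ (γ (k + 1))⁻¹ (p k ω) (d k ω) (a k ω) (g k ω) with hV_def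
  have hg : ∀ k ω, ‖g k ω‖ ≤ μ * ‖p k ω - a k ω‖ := by
    intro k ω
    have h : p k ω - a k ω = (2 : ℝ) • x (k + 1) ω - x k ω - z := by
      simp only [p, a, two_smul]; abel
    rw [h]
    exact hBlip.norm_sub_le _ _
  have hV0 : ∀ k ω, 0 ≤ V k ω := by
    intro k ω
    refine le_trans (mul_nonneg ?_ (sq_nonneg _))
      (sub_mul_norm_sq_le_reflectedEnergy hμ'.le (inv_pos.2 (hpos (k + 1))).le (hg k ω))
    have := hα (k + 2)
    nlinarith
  have hxm : ∀ {k n : ℕ}, k ≤ n → StronglyMeasurable[pastSigma x n] (x k) :=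
    fun hk => stronglyMeasurable_pastSigma x hk
  have hdm : ∀ k, StronglyMeasurable[pastSigma x (k + 2)] (d k) := fun k =>
    (hxm le_rfl).sub (hxm (by lia))
  have hpm : ∀ k, StronglyMeasurable[pastSigma x (k + 2)] (p k) := fun k =>
    (hxm le_rfl).sub stronglyMeasurable_const
  have hVm : ∀ k, StronglyMeasurable[pastSigma x (k + 2)] (V k) := by
    intro k
    have ham : StronglyMeasurable[pastSigma x (k + 2)] (a k) :=
      (hdm k).sub ((hxm (by lia)).sub (hxm (by lia)))
    have hgm : StronglyMeasurable[pastSigma x (k + 2)] (g k) :=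
      (stronglyMeasurable_reflected hBlip.continuous x (by lia)).sub stronglyMeasurable_const
    exact ((((hpm k).norm.pow 2).const_mul _).add (((hdm k).inner hgm).const_mul 2)).add
      (((hdm k).norm.pow 2).const_mul _) |>.add ((ham.norm.pow 2).const_mul _)
  have hRS := ae_tendsto_and_tsum_ne_top_of_noisy_descent (P := P)
    (ℱ := shiftedPastFiltration x halg.measurable) (e := e) (c := fun k ω => (-2 : ℝ) • p k ω)
    (β := fun _ => 16 / δ) (b := fun _ => 0) (V := V) (θ := fun k ω => δ / 2 * ‖d (k + 1) ω‖ ^ 2)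
    halg.integrable_estimatorNoise (halg.condExp_estimatorNoise hBlip.continuous)
    (fun _ => by positivity) (fun _ => le_rfl) summable_zero ?_
    (fun k => (hpm k).const_smul (-2 : ℝ)) hVm hV0 ?_ (fun k => ae_of_all _ fun ω => ?_) ?_
  · filter_upwards [hRS] with ω ⟨⟨l, hl⟩, hθ, hβ⟩
    have hd1 := tendsto_zero_of_tsum_ofReal_mul_norm_sq_ne_top (half_pos hδ) hθ
    have hd : Tendsto (fun k => x (k + 1) ω - x k ω) atTop (𝓝 0) :=
      (tendsto_add_atTop_iff_nat 2).1 hd1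
    have hd0 : Tendsto (fun k => d k ω) atTop (𝓝 0) := (tendsto_add_atTop_iff_nat 1).2 hd
    have ha : Tendsto (fun k => a k ω) atTop (𝓝 0) := by simpa using hd0.sub hd
    refine ⟨?_, hd, ?_⟩
    · obtain ⟨l', hl'⟩ := exists_tendsto_norm_of_tendsto_reflectedEnergy hμ' (fun k => hg k ω)
        (fun k => hα (k + 2)) (fun k => (inv_pos.2 (hpos (k + 1))).le)
        ((tendsto_add_atTop_iff_nat 2).2 hα₀) ((tendsto_add_atTop_iff_nat 1).2 hα₀) hd0 ha hl
      exact ⟨l', (tendsto_add_atTop_iff_nat 2).1 hl'⟩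
    · exact tendsto_zero_of_tsum_ofReal_mul_norm_sq_ne_top (c := 16 / δ) (by positivity)
        hβ.tsum_ofReal_ne_top
  · filter_upwards [hvar] with ω hω
    refine tsum_mul_condLExp_estimatorNoise_ne_top halg.measurable (xm := xm)
      (β := fun _ => ENNReal.ofReal (16 / δ)) ?_
    rw [ENNReal.tsum_mul_left]
    exact ENNReal.mul_lt_top ENNReal.ofReal_lt_top hω
  · exact fun k => ((((hdm (k + 1)).mono ((shiftedPastFiltration x halg.measurable).le
      (k + 2))).norm.pow 2).const_mul _).aestronglyMeasurable
  · exact mul_nonneg (half_pos hδ).le (sq_nonneg _)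
  · intro k
    filter_upwards [halg.ae_mem] with ω hu
    have hr : ∀ n, r (n + 1) ω = g n ω + B z + e n ω := fun n => by
      simp only [g, e, estimatorNoise]; abel
    have hu2 : -((γ (k + 1))⁻¹ • d k ω) - g k ω - e k ω - B z ∈ A (x (k + 2) ω) := by
      have h := hu (k + 1)
      rw [hr k] at h
      convert! h using 1
      simp only [d, smul_sub]
      abel
    have hu3 : -((γ (k + 2))⁻¹ • d (k + 1) ω) - g (k + 1) ω - e (k + 1) ω - B z
        ∈ A (x (k + 3) ω) := by
      have h := hu (k + 2)
      rw [hr (k + 1)] at h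
      convert! h using 1
      simp only [d, smul_sub]
      abel
    have hp3 : p (k + 1) ω = p k ω + d (k + 1) ω := by simp only [p, d]; abel
    have ha3 : a (k + 1) ω = d (k + 1) ω - d k ω := rfl
    have hstep := reflectedEnergy_step_le (μ := μ) (α := (γ (k + 2))⁻¹) (α' := (γ (k + 3))⁻¹)
      (β := (γ (k + 1))⁻¹) hμ'.le (p := p k ω) (d₁ := d k ω) (d₂ := d (k + 1) ω) (a₁ := a k ω)
      (g₁ := g k ω) (g₂ := g (k + 1) ω) (e₁ := e k ω) (e₂ := e (k + 1) ω) ?_ ?_ ?_ ?_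
      (hα (k + 1)) (hαanti (by lia))
    · rw [← hp3, ← ha3] at hstep
      -- Young's inequality splits the noise from the increment at the cost of half of `δ ‖d‖²`.
      have hy : -(2 * inner ℝ (d (k + 1) ω) ((2 : ℝ) • e (k + 1) ω - e k ω))
          ≤ δ / 2 * ‖d (k + 1) ω‖ ^ 2 + 16 / δ * ‖e (k + 1) ω‖ ^ 2 + 16 / δ * ‖e k ω‖ ^ 2 := by
        have h1 := (abs_le.1 (abs_real_inner_le_norm (d (k + 1) ω)
          ((2 : ℝ) • e (k + 1) ω - e k ω))).1
        have h2 : ‖(2 : ℝ) • e (k + 1) ω - e k ω‖ ≤ 2 * ‖e (k + 1) ω‖ + ‖e k ω‖ := by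
          refine (norm_sub_le _ _).trans (le_of_eq ?_)
          rw [norm_smul, Real.norm_of_nonneg zero_le_two]
        have h3 := mul_le_mul_of_nonneg_left h2 (norm_nonneg (d (k + 1) ω))
        have h4 : 2 * (‖d (k + 1) ω‖ * (2 * ‖e (k + 1) ω‖ + ‖e k ω‖))
            ≤ δ / 2 * ‖d (k + 1) ω‖ ^ 2 + 2 / δ * (2 * ‖e (k + 1) ω‖ + ‖e k ω‖) ^ 2 := by
          have h5 : 0 ≤ δ / 2 * (‖d (k + 1) ω‖ - 2 / δ * (2 * ‖e (k + 1) ω‖ + ‖e k ω‖)) ^ 2 := by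
            positivity
          have h6 : δ / 2 * (‖d (k + 1) ω‖ - 2 / δ * (2 * ‖e (k + 1) ω‖ + ‖e k ω‖)) ^ 2
              = δ / 2 * ‖d (k + 1) ω‖ ^ 2 - 2 * (‖d (k + 1) ω‖ * (2 * ‖e (k + 1) ω‖ + ‖e k ω‖))
                + 2 / δ * (2 * ‖e (k + 1) ω‖ + ‖e k ω‖) ^ 2 := by
            field_simp
            ring
          linarith
        have h7 : 2 / δ * (2 * ‖e (k + 1) ω‖ + ‖e k ω‖) ^ 2
            ≤ 2 / δ * (8 * ‖e (k + 1) ω‖ ^ 2 + 8 * ‖e k ω‖ ^ 2) := by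
          refine mul_le_mul_of_nonneg_left ?_ (by positivity)
          nlinarith [sq_nonneg (2 * ‖e (k + 1) ω‖ - ‖e k ω‖), sq_nonneg ‖e k ω‖]
        have h8 : 2 / δ * (8 * ‖e (k + 1) ω‖ ^ 2 + 8 * ‖e k ω‖ ^ 2)
            = 16 / δ * ‖e (k + 1) ω‖ ^ 2 + 16 / δ * ‖e k ω‖ ^ 2 := by ring
        linarith
      have h9 := mul_le_mul_of_nonneg_right (hγδ (k + 1)) (sq_nonneg ‖d (k + 1) ω‖)
      rw [div_eq_mul_inv, one_div] at h9
      rw [real_inner_smul_left]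
      simp only [hV_def]
      linarith
    · rw [← hp3]
      have h := hA.inner_nonneg hu3 hz
      rwa [sub_neg_eq_add, sub_add_cancel] at h
    · have h := hA.inner_nonneg hu3 hu2
      rwa [sub_sub_sub_cancel_right] at h
    · have h := hBmono.inner_ofFun_nonneg ((2 : ℝ) • x (k + 2) ω - x (k + 1) ω) z
      have h' : p k ω + d k ω = (2 : ℝ) • x (k + 2) ω - x (k + 1) ω - z := by
        simp only [p, d, two_smul]; abel
      rwa [h']
    · have h := hBlip.norm_sub_le ((2 : ℝ) • x (k + 2) ω - x (k + 1) ω)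
        ((2 : ℝ) • x (k + 1) ω - x k ω)
      have h1 : g (k + 1) ω - g k ω = B ((2 : ℝ) • x (k + 2) ω - x (k + 1) ω)
          - B ((2 : ℝ) • x (k + 1) ω - x k ω) := sub_sub_sub_cancel_right _ _ _
      have h2 : d k ω + a k ω = (2 : ℝ) • x (k + 2) ω - x (k + 1) ω
          - ((2 : ℝ) • x (k + 1) ω - x k ω) := by
        simp only [d, a, two_smul]; abel
      rwa [h1, h2]

/-- If `dom A` is bounded and `A` or `B` is uniformly monotone, square summable step sizes with
divergent sum give almost sure strong convergence to a zero. -/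
theorem IsStochasticReflectedFB.ae_tendsto_of_isUniformlyMonotone (hA : IsMonotone A)
    (hBlip : LipschitzWith μ B) (hBmono : IsMonotone (ofFun B))
    (halg : IsStochasticReflectedFB P A B γ xm x r) (hbd : Bornology.IsBounded (dom A))
    (hAB : IsUniformlyMonotone A ∨ IsUniformlyMonotone (ofFun B))
    (hγsq : Summable fun n => γ n ^ 2) (hγsum : ¬ Summable γ)
    (hvar : ∀ᵐ ω ∂P, ∑' n, ENNReal.ofReal (γ n ^ 2) * estimatorVariance P B xm x r n ω < ∞) {z : H}
    (hz : z ∈ zer (sum A (ofFun B))) : ∀ᵐ ω ∂P, Tendsto (fun n => x n ω) atTop (𝓝 z) := by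
  rw [mem_zer_sum_ofFun_iff] at hz
  have hpos := halg.step_pos
  obtain ⟨R, hR⟩ := hbd.exists_norm_le
  -- From `n = k + 2` on, both iterates that enter `y n` lie in `dom A`.
  set p : ℕ → Ω → H := fun k ω => x (k + 2) ω - z
  set d : ℕ → Ω → H := fun k ω => x (k + 2) ω - x (k + 1) ω
  set g : ℕ → Ω → H := fun k ω => B ((2 : ℝ) • x (k + 2) ω - x (k + 1) ω) - B z
  set e := estimatorNoise B x r
  -- `w k` is the difference between the element of `A (x (k + 3))` selected by the resolvent and
  -- the element `-B z` of `A z`.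
  set w : ℕ → Ω → H := fun k ω => -((γ (k + 2))⁻¹ • d (k + 1) ω) - g k ω - e (k + 1) ω
  set s : ℕ → Ω → ℝ := fun k ω =>
    inner ℝ (p k ω + d (k + 1) ω) (w k ω) + inner ℝ (p k ω + d k ω) (g k ω)
  have hp3 : ∀ k ω, p (k + 1) ω = p k ω + d (k + 1) ω := fun k ω => by simp only [p, d]; abel
  have hy : ∀ k ω, p k ω + d k ω = (2 : ℝ) • x (k + 2) ω - x (k + 1) ω - z := fun k ω => by
    simp only [p, d, two_smul]; abel
  have hu3 : ∀ᵐ ω ∂P, ∀ k, w k ω - B z ∈ A (x (k + 3) ω) := by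
    filter_upwards [halg.ae_mem] with ω hu k
    have h := hu (k + 2)
    convert! h using 1
    simp only [w, d, g, e, estimatorNoise, smul_sub]
    abel
  have hs1 : ∀ᵐ ω ∂P, ∀ k, 0 ≤ inner ℝ (p k ω + d (k + 1) ω) (w k ω) := by
    filter_upwards [hu3] with ω hu k
    have h := hA.inner_nonneg (hu k) hz
    rw [sub_neg_eq_add, sub_add_cancel] at h
    rwa [← hp3]
  have hs2 : ∀ k ω, 0 ≤ inner ℝ (p k ω + d k ω) (g k ω) := fun k ω => by
    rw [hy]
    exact hBmono.inner_ofFun_nonneg _ z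
  have hs : ∀ᵐ ω ∂P, ∀ k, 0 ≤ s k ω := by
    filter_upwards [hs1] with ω h k using add_nonneg (h k) (hs2 k ω)
  have hgM : ∀ᵐ ω ∂P, ∀ k, ‖g k ω‖ ≤ μ * (4 * R) := by
    filter_upwards [halg.ae_mem] with ω hu k
    refine (hBlip.norm_sub_le _ _).trans (mul_le_mul_of_nonneg_left ?_ μ.coe_nonneg)
    have h1 := hR _ ⟨_, hu (k + 1)⟩
    have h2 := hR _ ⟨_, hu k⟩
    have h3 := hR _ ⟨_, hz⟩
    have h4 := norm_sub_le ((2 : ℝ) • x (k + 2) ω - x (k + 1) ω) z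
    have h5 := norm_sub_le ((2 : ℝ) • x (k + 2) ω) (x (k + 1) ω)
    rw [norm_smul, Real.norm_of_nonneg zero_le_two] at h5
    linarith
  have hxm : ∀ {k n : ℕ}, k ≤ n → StronglyMeasurable[pastSigma x n] (x k) :=
    fun hk => stronglyMeasurable_pastSigma x hk
  have hdm : ∀ k, StronglyMeasurable[pastSigma x (k + 2)] (d k) := fun k =>
    (hxm le_rfl).sub (hxm (by lia))
  have hpm : ∀ k, StronglyMeasurable[pastSigma x (k + 2)] (p k) := fun k =>
    (hxm le_rfl).sub stronglyMeasurable_const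
  have hle : ∀ k, pastSigma x (k + 2) ≤ _ := fun k =>
    (shiftedPastFiltration x halg.measurable).le (k + 1)
  have hsm : ∀ k, AEStronglyMeasurable (s k) P := by
    intro k
    have hd1 := ((hdm (k + 1)).mono (hle (k + 1))).aestronglyMeasurable (μ := P)
    have hd0 := ((hdm k).mono (hle k)).aestronglyMeasurable (μ := P)
    have hp0 := ((hpm k).mono (hle k)).aestronglyMeasurable (μ := P)
    have hg0 : AEStronglyMeasurable (g k) P :=
      (((stronglyMeasurable_reflected hBlip.continuous x le_rfl).mono (hle k)).sub
        stronglyMeasurable_const).aestronglyMeasurable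
    have he0 := (halg.integrable_estimatorNoise (k + 1)).aestronglyMeasurable
    exact ((hp0.add hd1).inner (((hd1.const_smul _).neg.sub hg0).sub he0)).add
      ((hp0.add hd0).inner hg0)
  have hRS := ae_tendsto_and_tsum_ne_top_of_noisy_descent (P := P)
    (ℱ := shiftedPastFiltration x halg.measurable) (e := e)
    (c := fun k ω => (-(2 * γ (k + 2))) • p k ω)
    (β := fun k => 4 * γ (k + 1) ^ 2) (b := fun k => 8 * (μ * (4 * R)) ^ 2 * γ (k + 2) ^ 2)
    (V := fun k ω => ‖p k ω‖ ^ 2 + ‖d k ω‖ ^ 2 / 4)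
    (θ := fun k ω => ‖d (k + 1) ω‖ ^ 2 / 4 + 2 * γ (k + 2) * s k ω)
    halg.integrable_estimatorNoise (halg.condExp_estimatorNoise hBlip.continuous)
    (fun _ => by positivity) (fun _ => by positivity)
    (((summable_nat_add_iff 2).2 hγsq).mul_left _) ?_
    (fun k => (hpm k).const_smul (-(2 * γ (k + 2))))
    (fun k => ((hpm k).norm.pow 2).add
      ((continuous_id.div_const 4).comp_stronglyMeasurable ((hdm k).norm.pow 2)))
    (fun k ω => by positivity) (fun k => ?_) (fun k => ?_) (fun k => ?_)
  · filter_upwards [hRS, hs, hs1, hu3] with ω ⟨⟨l, hl⟩, hθ, _⟩ hs hs1 hu3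
    have hθ0 : ∀ k, 0 ≤ ‖d (k + 1) ω‖ ^ 2 / 4 + 2 * γ (k + 2) * s k ω := fun k => by
      have := mul_nonneg (mul_nonneg zero_le_two (hpos (k + 2)).le) (hs k)
      positivity
    have hθ' := ENNReal.summable_toReal hθ
    simp only [ENNReal.toReal_ofReal (hθ0 _)] at hθ'
    have hp := tendsto_zero_of_summable_mul (p := fun k => p k ω) (d := fun k => d k ω)
      (γ := fun k => γ (k + 2)) (s := fun k => s k ω) (fun k => (hpos _).le)
      (fun h => hγsum ((summable_nat_add_iff 2).1 h)) hs hl hθ' fun t ht => ?_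
    · rw [← tendsto_add_atTop_iff_nat 2]
      simpa [p] using hp.add_const z
    · rcases hAB with h | h
      · obtain ⟨η, hη, hle⟩ := h.exists_pos_le_inner hz ht
        refine ⟨η, hη, fun k h1 _ => ?_⟩
        have h2 := hle _ _ (hu3 k) h1
        rw [sub_neg_eq_add, sub_add_cancel] at h2
        have h3 : η ≤ inner ℝ (p k ω + d (k + 1) ω) (w k ω) := by
          rw [← hp3]
          exact h2
        exact h3.trans (le_add_of_nonneg_right (hs2 k ω))
      · obtain ⟨η, hη, hle⟩ := h.exists_pos_le_inner (z := z) (u := B z) rfl ht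
        refine ⟨η, hη, fun k _ h1 => ?_⟩
        rw [hy] at h1
        have h2 := hle _ _ rfl h1
        rw [← hy] at h2
        exact h2.trans (le_add_of_nonneg_left (hs1 k))
  · filter_upwards [hvar] with ω hω
    refine tsum_mul_condLExp_estimatorNoise_ne_top halg.measurable (xm := xm)
      (β := fun k => ENNReal.ofReal (4 * γ k ^ 2)) ?_
    simp only [ENNReal.ofReal_mul (show (0 : ℝ) ≤ 4 by norm_num), mul_assoc]
    rw [ENNReal.tsum_mul_left]
    exact ENNReal.mul_lt_top ENNReal.ofReal_lt_top hω
  · exact ((continuous_id.div_const 4).comp_aestronglyMeasurable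
      (((hdm (k + 1)).mono (hle (k + 1))).norm.pow 2).aestronglyMeasurable).add
      ((hsm k).const_mul _)
  · filter_upwards [hs] with ω h
    have := mul_nonneg (mul_nonneg zero_le_two (hpos (k + 2)).le) (h k)
    simp only [Pi.zero_apply]
    positivity
  · filter_upwards [hgM] with ω hg
    have h := norm_add_sq_add_le (hpos (k + 2)) (p := p k ω) (d₁ := d k ω) (d₂ := d (k + 1) ω)
      (e := e (k + 1) ω) (hg k)
    rw [← hp3] at h
    have h1 : 0 ≤ 4 * γ (k + 1) ^ 2 * ‖e k ω‖ ^ 2 := by positivity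
    rw [real_inner_smul_left]
    simp only [s, w, ← hp3]
    linarith

end Convergence

theorem theorem3p3
    {H : Type*} [NormedAddCommGroup H] [InnerProductSpace ℝ H] [CompleteSpace H]
    [TopologicalSpace.SeparableSpace H] [MeasurableSpace H] [BorelSpace H]
    {Ω : Type*} [MeasurableSpace Ω] (P : Measure Ω) [IsProbabilityMeasure P]
    (A : H → Set H) (hA : SetValued.IsMaximallyMonotone A)
    (B : H → H) (μ : ℝ≥0) (hμ : 0 < μ) (hBlip : LipschitzWith μ B)
    (hBmono : SetValued.IsMonotone (SetValued.ofFun B))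
    (γ : ℕ → ℝ) (hγ : ∀ n, γ n ∈ Set.Ioo 0 ((√2 - 1) / (μ : ℝ)))
    (xm : Ω → H) (x r : ℕ → Ω → H) (halg : IsStochasticReflectedFB P A B γ xm x r) :
    ((SetValued.zer (SetValued.sum A (SetValued.ofFun B))).Nonempty →
      Monotone γ →
      0 < ⨅ n : ℕ, (2 / γ (n + 1) - 1 / γ n - (μ : ℝ) * (1 + √2)) →
      (∀ᵐ ω ∂P, ∑' n, estimatorVariance P B xm x r n ω < ∞) →
      ∃ xbar : Ω → H, Measurable xbar ∧
        (∀ ω, xbar ω ∈ SetValued.zer (SetValued.sum A (SetValued.ofFun B))) ∧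
        ∀ᵐ ω ∂P, Tendsto (fun n => toWeakSpace ℝ H (x n ω)) atTop
          (𝓝 (toWeakSpace ℝ H (xbar ω)))) ∧
    (Bornology.IsBounded (SetValued.dom A) →
      (SetValued.IsUniformlyMonotone A ∨
        SetValued.IsUniformlyMonotone (SetValued.ofFun B)) →
      Antitone γ →
      (Summable fun n => γ n ^ 2) → ¬ Summable γ →
      (∀ᵐ ω ∂P, ∑' n, ENNReal.ofReal (γ n ^ 2) * estimatorVariance P B xm x r n ω < ∞) →
      ∃ xbar : H, SetValued.zer (SetValued.sum A (SetValued.ofFun B)) = {xbar} ∧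
        ∀ᵐ ω ∂P, Tendsto (fun n => x n ω) atTop (𝓝 xbar)) := by
  refine ⟨fun hne hmono hinf hvar => ?_, fun hbd hAB _ hsq hsum hvar => ?_⟩
  · have hbdd : BddBelow (Set.range fun n : ℕ =>
        2 / γ (n + 1) - 1 / γ n - (μ : ℝ) * (1 + √2)) := by
      -- The infimum of a family that is not bounded below is `0` by convention.
      by_contra h
      rw [Real.iInf_of_not_bddBelow h] at hinf
      exact lt_irrefl _ hinf
    set Z := SetValued.zer (SetValued.sum A (SetValued.ofFun B))
    -- The exceptional null set depends on the zero, so only countably many zeros are used.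
    obtain ⟨Q, hQZ, hQc, hQ⟩ :=
      (TopologicalSpace.IsSeparable.of_separableSpace Z).exists_countable_dense_subset
    have key : ∀ z ∈ Z, _ := fun z hz => halg.ae_tendsto_norm_sub hA.1 hμ hBlip hBmono
      (fun n => (hγ n).2) hmono hinf (fun n => ciInf_le hbdd n) hvar hz
    obtain ⟨z₀, hz₀⟩ := hne
    have hQae := (ae_ball_iff hQc).2 fun q hq => key q (hQZ hq)
    have hγinv : ∀ n, |(γ n)⁻¹| ≤ (γ 0)⁻¹ := fun n => by
      rw [abs_of_pos (inv_pos.2 (hγ n).1)]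
      exact inv_anti₀ (hγ 0).1 (hmono n.zero_le)
    have hweak : ∀ᵐ ω ∂P, ∃ a ∈ Z, ∀ v,
        Tendsto (fun n => inner ℝ (x n ω) v) atTop (𝓝 (inner ℝ a v)) := by
      filter_upwards [key z₀ hz₀, hQae, halg.ae_mem] with ω ⟨_, hd, he⟩ hq hu
      refine exists_mem_zer_forall_tendsto_inner hA hBlip hBmono ⟨z₀, hz₀⟩
        (y := fun n => reflectedPoint xm x n ω) hγinv hu (fun z hz =>
          exists_tendsto_norm_sub_of_subset_closure hQ (fun q hqQ => (hq q hqQ).1) hz) hd ?_ ?_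
      · rw [← tendsto_add_atTop_iff_nat 1]
        have h1 := ((tendsto_add_atTop_iff_nat 1).2 hd).sub hd
        rw [sub_zero] at h1
        refine h1.congr fun n => ?_
        simp only [reflectedPoint, two_smul]
        abel
      · exact (tendsto_add_atTop_iff_nat 1).1 he
    obtain ⟨xbar, hm, hmem, hlim⟩ :=
      exists_measurable_ae_tendsto_inner ⟨z₀, hz₀⟩ halg.measurable hweak
    refine ⟨xbar, hm, hmem, ?_⟩
    filter_upwards [hlim] with ω hω using tendsto_toWeakSpace_of_forall_inner hω
  · obtain ⟨z, hz⟩ := hA.zer_nonempty_of_isBounded_dom hBlip hBmono hbd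
    refine ⟨z, Set.eq_singleton_iff_unique_mem.2 ⟨hz, fun z' hz' =>
      hA.1.eq_of_mem_zer_of_isUniformlyMonotone hBmono hAB hz hz'⟩, ?_⟩
    exact halg.ae_tendsto_of_isUniformlyMonotone hA.1 hBlip hBmono hbd hAB hsq hsum hvar hz
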